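/- Let $r\ge 1$ be an integer. An $r$-kernel is a bounded measurable symmetric function $W:[0,1]^r\to\mathbb{R}$, and an $r$-graphon is a non-negative $r$-kernel. For an $r$-uniform hypergraph $\mathcal{H}$ with finite vertex set $V(\mathcal{H})$ and edge set $E(\mathcal{H})$, $e(\mathcal{H})=|E(\mathcal{H})|$, and an $r$-kernel $W$, let $$t_{\mathcal{H}}(W)=\int_{[0,1]^{V(\mathcal{H})}}\ \prod_{\{i_1,\dots,i_r\}\in E(\mathcal{H})}W(x_{i_1},\dots,x_{i_r})\ d\mu^{V(\mathcal{H})},$$ where $\mu$ is Lebesgue measure on $[0,1]$. Let $\mathcal{K}_r$ be the $r$-uniform hypergraph consisting of $r$ vertices and a single edge. The hypergraph $\mathcal{H}$ is called Sidorenko if $t_{\mathcal{H}}(W)\ge t_{\mathcal{K}_r}(W)^{e(\mathcal{H})}$ for all $r$-graphons $W$. For $\ell\ge r$, the tight cycle $\mathcal{C}_\ell^{(r)}$ is the $r$-uniform hypergraph with vertex set $\{1,\dots,\ell\}$ whose edges are the sets $\{i,i+1,\dots,i+r-1\}$ for $i=1,\dots,\ell$, with addition taken modulo $\ell$. Theorem.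 If $r\ge 3$ is odd and $\ell>r$, then $\mathcal{C}_\ell^{(r)}$ is not Sidorenko; that is, there is an $r$-graphon $W$ with $t_{\mathcal{C}_\ell^{(r)}}(W)<t_{\mathcal{K}_r}(W)^{e(\mathcal{C}_\ell^{(r)})}$. -/

import Mathlib

open MeasureTheory

/-- An `r`-uniform hypergraph (`r`-graph) on the vertex set `V`: a finite set of `r`-element
subsets of `V`. -/
structure RGraph (V : Type*) (r : ℕ) where
  edges : Finset (Finset V)
  card_edge : ∀ e ∈ edges, e.card = r

/-- An `r`-kernel: a bounded measurable symmetric function `[0,1]^r → ℝ`. -/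
structure RKernel (r : ℕ) where
  toFun : (Fin r → unitInterval) → ℝ
  measurable_toFun : Measurable toFun
  bounded : ∃ B : ℝ, ∀ x, |toFun x| ≤ B
  symmetric : ∀ (σ : Equiv.Perm (Fin r)) (x : Fin r → unitInterval), toFun (x ∘ σ) = toFun x

/-- An `r`-graphon is a non-negative `r`-kernel. -/
def RKernel.IsGraphon {r : ℕ} (W : RKernel r) : Prop :=
  ∀ x, 0 ≤ W.toFun x

/-- The value `W(x_{i_1}, …, x_{i_r})` for an `r`-element set `e = {i_1, …, i_r}` of vertices,
computed through some enumeration of `e`. -/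
noncomputable def RKernel.evalEdge {V : Type*} {r : ℕ} (W : RKernel r) (x : V → unitInterval)
    (e : Finset V) (he : e.card = r) : ℝ :=
  W.toFun fun k => x ((e.equivFinOfCardEq he).symm k)

/-- By symmetry of the kernel, the value on an edge does not depend on the enumeration. -/
theorem RKernel.evalEdge_eq {V : Type*} {r : ℕ} (W : RKernel r) (x : V → unitInterval)
    (e : Finset V) (he : e.card = r) (f : Fin r ≃ e) :
    W.evalEdge x e he = W.toFun fun k => x (f k) := by
  have h := W.symmetric (f.trans (e.equivFinOfCardEq he))
    (fun k => x ((e.equivFinOfCardEq he).symm k))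
  rw [RKernel.evalEdge, ← h]
  congr 1
  funext k
  simp

/-- The homomorphism density `t_H(W)`: the integral over `[0,1]^V` of the product over all
edges `{i_1, …, i_r}` of `H` of `W(x_{i_1}, …, x_{i_r})`. -/
noncomputable def RGraph.density {V : Type*} [Fintype V] {r : ℕ} (H : RGraph V r)
    (W : RKernel r) : ℝ :=
  ∫ x : V → unitInterval, ∏ e ∈ H.edges.attach, W.evalEdge x e.1 (H.card_edge e.1 e.2)

/-- The complete `r`-graph on `r` vertices, that is, a single edge. -/
def singleEdge (r : ℕ) : RGraph (Fin r) r where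
  edges := {Finset.univ}
  card_edge := by simp

/-- An `r`-graph `H` is Sidorenko if `t_H(W) ≥ t_{K_r}(W)^{e(H)}` for all `r`-graphons `W`. -/
def RGraph.IsSidorenko {V : Type*} [Fintype V] {r : ℕ} (H : RGraph V r) : Prop :=
  ∀ W : RKernel r, W.IsGraphon →
    (singleEdge r).density W ^ H.edges.card ≤ H.density W

/-- The set `{i, i+1, …, i+r-1}` in `{0, …, ℓ-1}`, with addition mod `ℓ`. -/
def cyclicInterval (r ℓ : ℕ) (i : Fin ℓ) : Finset (Fin ℓ) :=
  (Finset.range r).image fun j => ⟨(i.val + j) % ℓ, Nat.mod_lt _ i.pos⟩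

theorem card_cyclicInterval {r ℓ : ℕ} (h : r ≤ ℓ) (i : Fin ℓ) :
    (cyclicInterval r ℓ i).card = r := by
  rw [cyclicInterval, Finset.card_image_of_injOn, Finset.card_range]
  intro a ha b hb hab
  simp only [Finset.coe_range, Set.mem_Iio] at ha hb
  have h1 : i.val + a ≡ i.val + b [MOD ℓ] := congrArg Fin.val hab
  exact (Nat.ModEq.add_left_cancel' _ h1).eq_of_lt_of_lt (ha.trans_le h) (hb.trans_le h)

/-- The `r`-uniform tight cycle on `ℓ ≥ r` vertices: the edges are the sets
`{i, i+1, …, i+r-1}` of `r` cyclically consecutive vertices. -/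
def tightCycle (r ℓ : ℕ) (h : r ≤ ℓ) : RGraph (Fin ℓ) r where
  edges := Finset.univ.image (cyclicInterval r ℓ)
  card_edge := by
    intro e he
    obtain ⟨i, -, rfl⟩ := Finset.mem_image.mp he
    exact card_cyclicInterval h i

/-!
If `r` does not divide `ℓ`, the tight cycle is not `r`-partite: colours that are distinct on all
windows of length `r` have period `r` and period `ℓ`, hence also period `ℓ % r`. The complete
`r`-partite graphon then has positive edge density and contains no copy of the cycle
(`not_isSidorenko_of_not_dvd`).

If `ℓ = r k`, the graphon is `W(x) = 1 - c f(x₁) ⋯ f(x_r)`, where `f` is the indicator function of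
`[0, δ]` minus its mean. Its edge density is `1`. In the expansion of the density of the cycle, a
set `F` of edges contributes `(-c) ^ |F|` times the product over all vertices of the moment of `f`
of order the degree. The first moment vanishes and all moments of higher order are `δ + O(δ²)`, so
that for nonempty `F` only *double covers* survive, the sets `F` of edges for which all degrees are
at least two, and for small `δ` the density of the cycle is less than one as soon as the sum of
`(-c) ^ |F|` over the double covers is negative (`not_isSidorenko_of_sum_neg`).

Let `p_m` be the number of double covers with `m` edges. The smallest ones have `2k` edges, and
`p_{2k} ≤ r (r - 1) / 2`. A double cover is a cyclic sequence of starting points in which every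
second term is at most `r` further on. For even `m` the terms of even and of odd index can be
chosen separately, which bounds `p_m` by squares of numbers of compositions, with parts equal to
zero allowed (`card_basedDoubleCovers_even_le`). For `m = 2k + 1` the steps of length two visit the
whole sequence, and all compositions of `r` into `2k + 1` cyclically arranged parts occur, except
those concentrated on an arc of `k + 1` parts (`card_spreadCompositions_le`,
`choose_le_card_spreadCompositions`). So `p_{2k+1}` is so much larger than `p_{2k}` that for
`c = r (r - 1) / p`, with `p` the lower bound for `p_{2k+1}`, the covers with `2k + 1` edges have
at least twice the weight of those with `2k` edges, while the larger even covers are still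
suppressed by the powers of `c`; the larger odd covers contribute with the favourable sign.

The contribution of the larger even covers is bounded by a geometric series for almost all `(r, k)`
(`not_isSidorenko_of_oddBoundLarge`). For `r = 3` the complements of the covers are counted instead
(`not_isSidorenko_three`). For `k = 2`, and for `k = 3` and small `r`, it is enough that a cover
has two members in each of `k` consecutive blocks (`not_isSidorenko_two`). In six further cases
numerical values are inserted, where for `r = 5` and `4 ≤ k ≤ 6` the bound for `p_{2k+2}` comes
from the generating polynomials of the words of gaps (`card_doubleCovers_five_le`).
-/

/-! ### Densities in tight cycles -/

theorem mem_cyclicInterval {r ℓ : ℕ} {i v : Fin ℓ} :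
    v ∈ cyclicInterval r ℓ i ↔ ∃ j < r, (i.val + j) % ℓ = v.val := by
  simp [cyclicInterval, Fin.ext_iff]

theorem cyclicInterval_injective {r ℓ : ℕ} (hr : 0 < r) (hℓ : r < ℓ) :
    Function.Injective (cyclicInterval r ℓ) := by
  -- The predecessor of `a` is the only vertex outside the interval whose successor is inside.
  intro a b hab
  have ha : a ∈ cyclicInterval r ℓ b := by
    rw [← hab, mem_cyclicInterval]
    exact ⟨0, hr, by simp [Nat.mod_eq_of_lt a.2]⟩
  obtain ⟨j, hj, hja⟩ := mem_cyclicInterval.1 ha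
  rcases Nat.eq_zero_or_pos j with rfl | hj0
  · ext
    rw [← hja, Nat.add_zero, Nat.mod_eq_of_lt b.2]
  exfalso
  have hmem : (⟨(b.val + (j - 1)) % ℓ, Nat.mod_lt _ b.pos⟩ : Fin ℓ) ∈ cyclicInterval r ℓ b :=
    mem_cyclicInterval.2 ⟨j - 1, by omega, rfl⟩
  rw [← hab, mem_cyclicInterval] at hmem
  obtain ⟨i, hi, hia⟩ := hmem
  have h1 : a.val + (i + 1) ≡ a.val + 0 [MOD ℓ] := by
    have h2 : a.val + i ≡ b.val + (j - 1) [MOD ℓ] := by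
      simpa [Nat.ModEq] using hia
    have h3 : b.val + j ≡ a.val [MOD ℓ] := by
      simp [Nat.ModEq, hja, Nat.mod_eq_of_lt a.2]
    have h4 := h2.add_right 1
    rw [show b.val + (j - 1) + 1 = b.val + j by omega] at h4
    exact h4.trans h3
  have h5 := (Nat.ModEq.add_left_cancel' _ h1).eq_of_lt_of_lt (by omega) (by omega)
  omega

theorem density_tightCycle {r ℓ : ℕ} (hr : 0 < r) (hℓ : r < ℓ) (W : RKernel r) :
    (tightCycle r ℓ hℓ.le).density W = ∫ x : Fin ℓ → unitInterval,
      ∏ i, W.evalEdge x (cyclicInterval r ℓ i) (card_cyclicInterval hℓ.le i) := by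
  rw [RGraph.density]
  congr 1
  funext x
  symm
  refine Finset.prod_bij (fun i _ => ⟨cyclicInterval r ℓ i, by simp [tightCycle]⟩) ?_ ?_ ?_ ?_
  · simp
  · intro a _ b _ hab
    exact cyclicInterval_injective hr hℓ (congrArg Subtype.val hab)
  · rintro ⟨e, he⟩ -
    obtain ⟨i, -, rfl⟩ := Finset.mem_image.1 he
    exact ⟨i, Finset.mem_univ _, rfl⟩
  · intros
    rfl

theorem density_singleEdge {r : ℕ} (W : RKernel r) :
    (singleEdge r).density W = ∫ x : Fin r → unitInterval, W.toFun x := by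
  rw [RGraph.density]
  congr 1
  funext x
  have h : (singleEdge r).edges.attach = {⟨Finset.univ, by simp [singleEdge]⟩} := by
    ext ⟨e, he⟩
    have := he
    simp only [singleEdge, Finset.mem_singleton] at this
    simp [this]
  rw [h, Finset.prod_singleton,
    W.evalEdge_eq x _ _ (Equiv.subtypeUnivEquiv (fun x => Finset.mem_univ x)).symm]
  rfl

/-! ### Kernels that are one minus a product -/

/-- The `r`-kernel `(x₁, …, x_r) ↦ 1 - c f(x₁) ⋯ f(x_r)`, for measurable `f` with values
in `[-1, 1]`. -/
noncomputable def oneSubProdKernel (r : ℕ) (c : ℝ) (f : unitInterval → ℝ) (hf : Measurable f)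
    (hb : ∀ x, |f x| ≤ 1) : RKernel r where
  toFun x := 1 - c * ∏ i, f (x i)
  measurable_toFun := by fun_prop
  bounded := by
    refine ⟨1 + |c|, fun x => ?_⟩
    have h : |∏ i, f (x i)| ≤ 1 := by
      rw [Finset.abs_prod]
      exact Finset.prod_le_one (fun _ _ => abs_nonneg _) fun _ _ => hb _
    calc |1 - c * ∏ i, f (x i)| ≤ |1| + |c * ∏ i, f (x i)| := abs_sub _ _
      _ ≤ 1 + |c| := by
        rw [abs_one, abs_mul]
        gcongr
        exact mul_le_of_le_one_right (abs_nonneg _) h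
  symmetric σ x := by
    simp only [Function.comp_apply]
    rw [Equiv.prod_comp σ fun i => f (x i)]

section OneSubProd

variable {r : ℕ} {c : ℝ} {f : unitInterval → ℝ} (hf : Measurable f) (hb : ∀ x, |f x| ≤ 1)

theorem oneSubProdKernel_isGraphon (h0 : 0 ≤ c) (h1 : c ≤ 1) :
    (oneSubProdKernel r c f hf hb).IsGraphon := by
  intro x
  have h : |∏ i, f (x i)| ≤ 1 := by
    rw [Finset.abs_prod]
    exact Finset.prod_le_one (fun _ _ => abs_nonneg _) fun _ _ => hb _
  have h2 := le_of_abs_le h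
  simp only [oneSubProdKernel]
  nlinarith

theorem evalEdge_oneSubProdKernel {V : Type*} (x : V → unitInterval) (e : Finset V)
    (he : e.card = r) :
    (oneSubProdKernel r c f hf hb).evalEdge x e he = 1 - c * ∏ v ∈ e, f (x v) := by
  rw [RKernel.evalEdge]
  simp only [oneSubProdKernel]
  rw [Equiv.prod_comp (e.equivFinOfCardEq he).symm fun v => f (x v),
    Finset.prod_coe_sort e fun v => f (x v)]

theorem integrable_pow_of_abs_le_one (hf : Measurable f) (hb : ∀ x, |f x| ≤ 1) (d : ℕ) :
    Integrable fun x => f x ^ d := by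
  refine Integrable.of_bound (hf.pow_const d).aestronglyMeasurable 1 (ae_of_all _ fun x => ?_)
  rw [norm_pow]
  exact pow_le_one₀ (norm_nonneg _) (hb x)

theorem density_singleEdge_oneSubProdKernel (hr : 0 < r) (h0 : ∫ x, f x = 0) :
    (singleEdge r).density (oneSubProdKernel r c f hf hb) = 1 := by
  rw [density_singleEdge]
  simp only [oneSubProdKernel]
  have hi : Integrable fun x : Fin r → unitInterval => ∏ i, f (x i) := by
    apply Integrable.fintype_prod (f := fun _ => f)
    intro i
    simpa using integrable_pow_of_abs_le_one hf hb 1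
  rw [integral_sub (integrable_const _) (hi.const_mul c), integral_const_mul,
    integral_fintype_prod_volume_eq_prod (fun _ : Fin r => f)]
  have : NeZero r := ⟨hr.ne'⟩
  simp [h0, Finset.prod_const]
  right
  omega

/-- Expanding the product over the edges writes the density of a tight cycle as a sum over its
subhypergraphs, in which each vertex contributes the moment of order its degree. -/
theorem density_tightCycle_oneSubProdKernel {ℓ : ℕ} (hr : 0 < r) (hℓ : r < ℓ) :
    (tightCycle r ℓ hℓ.le).density (oneSubProdKernel r c f hf hb) =
      ∑ F : Finset (Fin ℓ), (-c) ^ F.card *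
        ∏ v, ∫ x, f x ^ (F.filter fun i => v ∈ cyclicInterval r ℓ i).card := by
  rw [density_tightCycle hr hℓ]
  have h : ∀ x : Fin ℓ → unitInterval,
      ∏ i, (oneSubProdKernel r c f hf hb).evalEdge x (cyclicInterval r ℓ i)
        (card_cyclicInterval hℓ.le i) = ∑ F : Finset (Fin ℓ), (-c) ^ F.card *
        ∏ v, f (x v) ^ (F.filter fun i => v ∈ cyclicInterval r ℓ i).card := by
    intro x
    simp only [evalEdge_oneSubProdKernel, sub_eq_add_neg, ← neg_mul]
    rw [Finset.prod_one_add, Finset.powerset_univ]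
    refine Finset.sum_congr rfl fun F _ => ?_
    rw [Finset.prod_mul_distrib, Finset.prod_const]
    congr 1
    have h1 : ∀ i : Fin ℓ, ∏ v ∈ cyclicInterval r ℓ i, f (x v) =
        ∏ v, if v ∈ cyclicInterval r ℓ i then f (x v) else 1 := by
      intro i
      rw [Finset.prod_ite_mem, Finset.univ_inter]
    simp only [h1]
    rw [Finset.prod_comm]
    refine Finset.prod_congr rfl fun v _ => ?_
    rw [Finset.prod_ite, Finset.prod_const, Finset.prod_const_one, mul_one]
  simp only [h]
  have hi : ∀ F : Finset (Fin ℓ), Integrable fun x : Fin ℓ → unitInterval =>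
      (-c) ^ F.card * ∏ v, f (x v) ^ (F.filter fun i => v ∈ cyclicInterval r ℓ i).card := by
    intro F
    refine Integrable.const_mul ?_ _
    exact Integrable.fintype_prod
      (f := fun (v : Fin ℓ) x => f x ^ (F.filter fun i => v ∈ cyclicInterval r ℓ i).card)
      fun v => integrable_pow_of_abs_le_one hf hb _
  rw [integral_finsetSum _ fun F _ => hi F]
  refine Finset.sum_congr rfl fun F _ => ?_
  rw [integral_const_mul]
  congr 1
  exact integral_fintype_prod_volume_eq_prod
    (fun (v : Fin ℓ) x => f x ^ (F.filter fun i => v ∈ cyclicInterval r ℓ i).card)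

end OneSubProd

/-! ### Concentrating the perturbation on a small set -/

/-- The number of edges of the tight cycle that contain `v` and start at an element of `F`. -/
def cycleDegree {ℓ : ℕ} (r : ℕ) (F : Finset (Fin ℓ)) (v : Fin ℓ) : ℕ :=
  (F.filter fun i => v ∈ cyclicInterval r ℓ i).card

/-- A set of edges of the tight cycle, given by their starting points, is a double cover if each
vertex lies in at least two of these edges. -/
def IsDoubleCover {ℓ : ℕ} (r : ℕ) (F : Finset (Fin ℓ)) : Prop :=
  ∀ v, 2 ≤ cycleDegree r F v

instance {ℓ : ℕ} (r : ℕ) (F : Finset (Fin ℓ)) : Decidable (IsDoubleCover r F) := by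
  unfold IsDoubleCover; infer_instance

/-- A nonempty set of edges that misses a vertex has a vertex of degree one, namely the starting
point of the first of these edges behind the missed vertex. -/
theorem exists_cycleDegree_eq_one {r ℓ : ℕ} (hr : 0 < r) (hℓ : r < ℓ) {F : Finset (Fin ℓ)}
    (hF : F.Nonempty) {v : Fin ℓ} (hv : cycleDegree r F v = 0) :
    ∃ w, cycleDegree r F w = 1 := by
  have : NeZero ℓ := ⟨by omega⟩
  obtain ⟨i, hiF, hi⟩ := F.exists_min_image (fun i => (i - v).val) hF
  refine ⟨i, ?_⟩
  rw [cycleDegree, Finset.card_eq_one]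
  refine ⟨i, Finset.eq_singleton_iff_unique_mem.2 ⟨?_, ?_⟩⟩
  · exact Finset.mem_filter.2 ⟨hiF, mem_cyclicInterval.2 ⟨0, hr, by simp [Nat.mod_eq_of_lt i.2]⟩⟩
  · intro j hj
    obtain ⟨hjF, hji⟩ := Finset.mem_filter.1 hj
    have hjv : v ∉ cyclicInterval r ℓ j := by
      intro h
      have : j ∈ F.filter fun i => v ∈ cyclicInterval r ℓ i := Finset.mem_filter.2 ⟨hjF, h⟩
      rw [Finset.card_eq_zero.1 hv] at this
      simp at this
    have hle := hi j hjF
    obtain ⟨s, hs, hsi⟩ := mem_cyclicInterval.1 hji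
    by_contra hne
    have hs0 : s ≠ 0 := by
      rintro rfl
      apply hne
      ext
      rw [← hsi, Nat.add_zero, Nat.mod_eq_of_lt j.2]
    -- `j` precedes `i` by `s < r` steps, and `v` lies strictly before `j` or in between.
    rw [Fin.val_sub, Fin.val_sub] at hle
    apply hjv
    rw [mem_cyclicInterval]
    have hjl := j.2
    have hvl := v.2
    have hil := i.2
    have e1 : (j.val + s) % ℓ = if j.val + s < ℓ then j.val + s else j.val + s - ℓ := by
      split_ifs with h
      · exact Nat.mod_eq_of_lt h
      · rw [Nat.mod_eq_sub_mod (by omega), Nat.mod_eq_of_lt (by omega)]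
    have e2 : ∀ x : ℕ, x < ℓ →
        (ℓ - v.val + x) % ℓ = if v.val ≤ x then x - v.val else ℓ - v.val + x := by
      intro x hx
      split_ifs with h
      · rw [Nat.mod_eq_sub_mod (by omega), Nat.mod_eq_of_lt (by omega)]
        omega
      · exact Nat.mod_eq_of_lt (by omega)
    rw [e1] at hsi
    rw [e2 _ hjl, e2 _ hil] at hle
    by_cases hvj : j.val ≤ v.val
    · refine ⟨v.val - j.val, ?_, ?_⟩
      · split_ifs at hsi hle <;> omega
      · rw [show j.val + (v.val - j.val) = v.val by omega, Nat.mod_eq_of_lt hvl]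
    · refine ⟨v.val + ℓ - j.val, ?_, ?_⟩
      · split_ifs at hsi hle <;> omega
      · rw [show j.val + (v.val + ℓ - j.val) = v.val + ℓ by omega, Nat.add_mod_right,
          Nat.mod_eq_of_lt hvl]

/-- The centred indicator function of the interval `[0, δ]`. -/
noncomputable def centredIndicator (δ : unitInterval) : unitInterval → ℝ :=
  fun x => (Set.Iic δ).indicator 1 x - δ

theorem measurable_centredIndicator (δ : unitInterval) : Measurable (centredIndicator δ) :=
  (measurable_one.indicator measurableSet_Iic).sub_const _

theorem abs_centredIndicator_le (δ x : unitInterval) : |centredIndicator δ x| ≤ 1 := by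
  have h0 := δ.2.1
  have h1 := δ.2.2
  unfold centredIndicator Set.indicator
  split_ifs
  · rw [abs_le, Pi.one_apply]; constructor <;> linarith
  · rw [abs_le]; constructor <;> linarith

theorem integral_centredIndicator_pow (δ : unitInterval) (d : ℕ) :
    ∫ x, centredIndicator δ x ^ d = δ * (1 - δ : ℝ) ^ d + (1 - δ) * (-δ : ℝ) ^ d := by
  have h : ∀ x, centredIndicator δ x ^ d =
      (Set.Iic δ).indicator (fun _ => (1 - δ : ℝ) ^ d - (-δ : ℝ) ^ d) x + (-δ : ℝ) ^ d := by
    intro x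
    unfold centredIndicator Set.indicator
    split_ifs <;> simp
  simp only [h]
  rw [integral_add ((integrable_const _).indicator measurableSet_Iic) (integrable_const _),
    integral_indicator_const _ measurableSet_Iic, measureReal_def, unitInterval.volume_Iic]
  simp [ENNReal.toReal_ofReal δ.2.1]
  ring

/-- If the sum of `(-c) ^ |F|` over all double covers `F` is negative for some `c ∈ [0, 1]`, then
the kernels `1 - c ∏ f(xᵢ)`, with `f` the centred indicator of a short interval, show that the
tight cycle is not Sidorenko. -/
theorem not_isSidorenko_of_sum_neg {r ℓ : ℕ} (hr : 0 < r) (hℓ : r < ℓ) {c : ℝ} (h0 : 0 ≤ c)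
    (h1 : c ≤ 1)
    (hneg : ∑ F : Finset (Fin ℓ) with IsDoubleCover r F, (-c) ^ F.card < 0) :
    ¬ (tightCycle r ℓ hℓ.le).IsSidorenko := by
  intro hS
  have : NeZero ℓ := ⟨by omega⟩
  -- `q d δ` is the moment of order `d` of the centred indicator, divided by `δ`.
  let q : ℕ → ℝ → ℝ := fun d δ => (1 - δ) ^ d + (1 - δ) * ((-1) ^ d * δ ^ (d - 1))
  have hq0 : ∀ d, 2 ≤ d → q d 0 = 1 := by
    intro d hd
    have : d - 1 ≠ 0 := by omega
    simp [q, this]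
  have hqδ : ∀ d, 2 ≤ d → ∀ δ : unitInterval,
      ∫ x, centredIndicator δ x ^ d = δ * q d δ := by
    intro d hd δ
    obtain ⟨e, rfl⟩ : ∃ e, d = e + 1 := ⟨d - 1, by omega⟩
    rw [integral_centredIndicator_pow]
    simp only [q, Nat.add_sub_cancel]
    rw [neg_pow]
    ring
  let Q : ℝ → ℝ := fun δ => ∑ F : Finset (Fin ℓ) with IsDoubleCover r F,
    (-c) ^ F.card * ∏ v, q (cycleDegree r F v) δ
  have hQc : Continuous Q := by
    simp only [Q, q]
    fun_prop
  have hQ0 : Q 0 < 0 := by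
    refine lt_of_eq_of_lt (Finset.sum_congr rfl fun F hF => ?_) hneg
    rw [Finset.prod_congr rfl fun v _ => hq0 _ ((Finset.mem_filter.1 hF).2 v),
      Finset.prod_const_one, mul_one]
  obtain ⟨ε, hε, hball⟩ := Metric.continuousAt_iff.1 hQc.continuousAt (-Q 0) (by linarith)
  have hδ1 : min (ε / 2) 1 ≤ 1 := min_le_right _ _
  have hδ0 : 0 < min (ε / 2) 1 := lt_min (by linarith) one_pos
  let δ : unitInterval := ⟨min (ε / 2) 1, hδ0.le, hδ1⟩
  have hQδ : Q δ < 0 := by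
    have h2 := hball (x := (δ : ℝ)) (by
      rw [Real.dist_eq, sub_zero, abs_of_pos hδ0]
      exact (min_le_left _ _).trans_lt (by linarith))
    rw [Real.dist_eq] at h2
    linarith [le_abs_self (Q δ - Q 0)]
  have hm := measurable_centredIndicator δ
  have hb := abs_centredIndicator_le δ
  have hm1 : ∫ x, centredIndicator δ x = 0 := by
    have := integral_centredIndicator_pow δ 1
    simp only [pow_one] at this
    rw [this]
    ring
  have hle := hS _ (oneSubProdKernel_isGraphon (r := r) hm hb h0 h1)
  rw [density_singleEdge_oneSubProdKernel hm hb hr hm1, one_pow,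
    density_tightCycle_oneSubProdKernel hm hb hr hℓ] at hle
  rw [← Finset.add_sum_erase _ _ (Finset.mem_univ ∅)] at hle
  have hempty : (-c) ^ (∅ : Finset (Fin ℓ)).card *
      ∏ v, ∫ x, centredIndicator δ x ^
        ((∅ : Finset (Fin ℓ)).filter fun i => v ∈ cyclicInterval r ℓ i).card = 1 := by
    simp
  have hrest : ∑ F ∈ (Finset.univ : Finset (Finset (Fin ℓ))).erase ∅, (-c) ^ F.card *
      ∏ v, ∫ x, centredIndicator δ x ^ (F.filter fun i => v ∈ cyclicInterval r ℓ i).card =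
      δ ^ ℓ * Q δ := by
    simp only [Q]
    rw [Finset.mul_sum]
    symm
    refine Finset.sum_subset_zero_on_sdiff ?_ ?_ ?_
    · intro F hF
      refine Finset.mem_erase.2 ⟨?_, Finset.mem_univ _⟩
      rintro rfl
      have := (Finset.mem_filter.1 hF).2 0
      simp [cycleDegree] at this
    · intro F hF
      obtain ⟨hF1, hF2⟩ := Finset.mem_sdiff.1 hF
      have hF3 : ∃ v, cycleDegree r F v < 2 := by
        by_contra! h
        exact hF2 (Finset.mem_filter.2 ⟨Finset.mem_univ _, h⟩)
      obtain ⟨w, hw⟩ : ∃ w, cycleDegree r F w = 1 := by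
        obtain ⟨v, hv⟩ := hF3
        rcases Nat.lt_or_ge (cycleDegree r F v) 1 with h | h
        · exact exists_cycleDegree_eq_one hr hℓ
            (Finset.nonempty_iff_ne_empty.2 (Finset.ne_of_mem_erase hF1)) (Nat.lt_one_iff.1 h)
        · exact ⟨v, by omega⟩
      refine mul_eq_zero_of_right _ (Finset.prod_eq_zero (Finset.mem_univ w) ?_)
      rw [cycleDegree] at hw
      simp only [hw, pow_one, hm1]
    · intro F hF
      have h2 : ∀ v, ∫ x, centredIndicator δ x ^
          (F.filter fun i => v ∈ cyclicInterval r ℓ i).card = δ * q (cycleDegree r F v) δ :=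
        fun v => hqδ _ ((Finset.mem_filter.1 hF).2 v) δ
      simp only [h2]
      rw [Finset.prod_mul_distrib, Finset.prod_const, Finset.card_univ, Fintype.card_fin]
      ring
  rw [hempty, hrest] at hle
  have : 0 < (δ : ℝ) ^ ℓ := pow_pos hδ0 ℓ
  nlinarith

/-! ### Lengths that are not a multiple of the uniformity -/

/-- The index in `{0, …, r-1}` of the part of `[0, 1]`, divided into `r` intervals of equal
length, that contains `x`. -/
noncomputable def partIndex (r : ℕ) (x : unitInterval) : ℕ :=
  min ⌊(r : ℝ) * x⌋₊ (r - 1)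

theorem partIndex_lt {r : ℕ} (hr : 0 < r) (x : unitInterval) : partIndex r x < r := by
  unfold partIndex
  omega

theorem measurable_partIndex (r : ℕ) : Measurable (partIndex r) := by
  unfold partIndex
  exact (Nat.measurable_floor.comp (measurable_const.mul measurable_subtype_coe)).min
    measurable_const

open Classical in
/-- The complete balanced `r`-partite `r`-graphon. -/
noncomputable def completePartiteKernel (r : ℕ) : RKernel r where
  toFun x := if Function.Injective fun i => partIndex r (x i) then 1 else 0
  measurable_toFun := by
    refine Measurable.ite ?_ measurable_const measurable_const
    have h : Measurable fun (x : Fin r → unitInterval) i => partIndex r (x i) :=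
      measurable_pi_lambda _ fun i => (measurable_partIndex r).comp (measurable_pi_apply i)
    exact h (MeasurableSet.of_discrete (s := {y : Fin r → ℕ | Function.Injective y}))
  bounded := by
    refine ⟨1, fun x => ?_⟩
    split_ifs <;> simp
  symmetric σ x := by
    congr 1
    exact propext (Equiv.injective_comp σ fun i => partIndex r (x i))

theorem completePartiteKernel_isGraphon (r : ℕ) : (completePartiteKernel r).IsGraphon := by
  intro x
  simp only [completePartiteKernel]
  split_ifs <;> simp

theorem density_singleEdge_completePartiteKernel_pos {r : ℕ} (hr : 0 < r) :
    0 < (singleEdge r).density (completePartiteKernel r) := by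
  have hr' : (0 : ℝ) < r := by exact_mod_cast hr
  have hlo : ∀ i : Fin r, (i : ℝ) / r ∈ unitInterval := fun i =>
    ⟨by positivity, by rw [div_le_one hr']; exact_mod_cast i.2.le⟩
  have hhi : ∀ i : Fin r, ((i : ℝ) + 1) / r ∈ unitInterval := fun i =>
    ⟨by positivity, by rw [div_le_one hr']; exact_mod_cast i.2⟩
  let s : Set (Fin r → unitInterval) :=
    Set.univ.pi fun i => Set.Ioo ⟨(i : ℝ) / r, hlo i⟩ ⟨((i : ℝ) + 1) / r, hhi i⟩
  have hs : MeasurableSet s := MeasurableSet.univ_pi fun i => measurableSet_Ioo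
  have hpos : 0 < volume.real s := by
    rw [measureReal_def, volume_pi_pi, ENNReal.toReal_prod]
    refine Finset.prod_pos fun i _ => ?_
    rw [unitInterval.volume_Ioo]
    simp only
    rw [ENNReal.toReal_ofReal (by rw [← sub_div]; simp), ← sub_div]
    simpa using hr
  rw [density_singleEdge]
  refine hpos.trans_le ?_
  rw [← integral_indicator_one hs]
  have hint : Integrable (completePartiteKernel r).toFun := by
    obtain ⟨B, hB⟩ := (completePartiteKernel r).bounded
    exact Integrable.of_bound (completePartiteKernel r).measurable_toFun.aestronglyMeasurable B
      (ae_of_all _ hB)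
  refine integral_mono ((integrable_const _).indicator hs) hint fun x => ?_
  by_cases hx : x ∈ s
  · have hidx : ∀ i, partIndex r (x i) = i := by
      intro i
      have h := hx i (Set.mem_univ i)
      have h1 : (i : ℝ) / r < x i := h.1
      have h2 : (x i : ℝ) < (i + 1) / r := h.2
      rw [div_lt_iff₀ hr'] at h1
      rw [lt_div_iff₀ hr'] at h2
      have h3 : ⌊(r : ℝ) * x i⌋₊ = i := by
        rw [Nat.floor_eq_iff (mul_nonneg hr'.le (x i).2.1)]
        constructor <;> linarith
      have := i.2
      rw [partIndex, h3]
      omega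
    have hinj : Function.Injective fun i => partIndex r (x i) := by
      simp only [hidx]
      exact Fin.val_injective
    rw [Set.indicator_of_mem hx]
    simp [completePartiteKernel, hinj]
  · rw [Set.indicator_of_notMem hx]
    exact completePartiteKernel_isGraphon r x

/-- A tight cycle whose length is not a multiple of `r` is not `r`-partite. -/
theorem density_tightCycle_completePartiteKernel {r ℓ : ℕ} (hr : 0 < r) (hℓ : r < ℓ)
    (hdvd : ¬ r ∣ ℓ) : (tightCycle r ℓ hℓ.le).density (completePartiteKernel r) = 0 := by
  have : NeZero ℓ := ⟨by omega⟩
  rw [density_tightCycle hr hℓ]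
  refine integral_eq_zero_of_ae (ae_of_all _ fun x => ?_)
  rw [Pi.zero_apply]
  by_contra hne
  replace hne := Finset.prod_ne_zero_iff.1 hne
  -- `y` is the periodic sequence of part indices; it takes distinct values on `r` consecutive
  -- integers, so it has period `r` as well, hence also period `ℓ % r`.
  let y : ℕ → ℕ := fun n => partIndex r (x (Fin.ofNat ℓ n))
  have hinj : ∀ n i j, i < r → j < r → y (n + i) = y (n + j) → i = j := by
    intro n i j hi hj hij
    have h := hne (Fin.ofNat ℓ n) (Finset.mem_univ _)
    rw [RKernel.evalEdge] at h
    simp only [completePartiteKernel, ne_eq, ite_eq_right_iff, one_ne_zero, imp_false,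
      not_not] at h
    have hmem : ∀ i, i < r → Fin.ofNat ℓ (n + i) ∈ cyclicInterval r ℓ (Fin.ofNat ℓ n) :=
      fun i hi => mem_cyclicInterval.2 ⟨i, hi, by simp⟩
    let g := (cyclicInterval r ℓ (Fin.ofNat ℓ n)).equivFinOfCardEq
      (card_cyclicInterval hℓ.le (Fin.ofNat ℓ n))
    have h1 := h (a₁ := g ⟨_, hmem i hi⟩) (a₂ := g ⟨_, hmem j hj⟩)
      (by simp only [g, Equiv.symm_apply_apply]; exact hij)
    have h2 := congrArg Subtype.val (g.injective h1)
    have h3 : n + i ≡ n + j [MOD ℓ] := congrArg Fin.val h2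
    exact (Nat.ModEq.add_left_cancel' _ h3).eq_of_lt_of_lt (by omega) (by omega)
  have hlt : ∀ n, y n < r := fun n => partIndex_lt hr _
  have hperℓ : Function.Periodic y ℓ := by
    intro n
    simp only [y]
    congr 2
    ext
    simp
  have hperr : Function.Periodic y r := by
    intro n
    have himg : (Finset.range r).image (fun i => y (n + i)) = Finset.range r := by
      refine Finset.eq_of_subset_of_card_le ?_ ?_
      · intro m hm
        obtain ⟨i, -, rfl⟩ := Finset.mem_image.1 hm
        exact Finset.mem_range.2 (hlt _)
      · rw [Finset.card_image_of_injOn fun i hi j hj hij => hinj n i j (by simpa using hi)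
          (by simpa using hj) hij]
    have hm : y (n + r) ∈ (Finset.range r).image fun i => y (n + i) := by
      rw [himg]
      exact Finset.mem_range.2 (hlt _)
    obtain ⟨i, hi, hir⟩ := Finset.mem_image.1 hm
    rcases Nat.eq_zero_or_pos i with rfl | hi0
    · exact hir.symm
    · have hi' := Finset.mem_range.1 hi
      have := hinj (n + 1) (i - 1) (r - 1) (by omega) (by omega)
        (by rw [show n + 1 + (i - 1) = n + i by omega, show n + 1 + (r - 1) = n + r by omega]
            exact hir)
      omega
  have hmod : y (0 + ℓ % r) = y (0 + 0) := by
    have h1 : y ℓ = y 0 := by simpa using hperℓ 0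
    rw [← hperr.map_mod_nat ℓ] at h1
    simpa using h1
  have h0 := hinj 0 _ _ (Nat.mod_lt ℓ hr) hr hmod
  exact hdvd (Nat.dvd_of_mod_eq_zero h0)

theorem not_isSidorenko_of_not_dvd {r ℓ : ℕ} (hr : 0 < r) (hℓ : r < ℓ) (hdvd : ¬ r ∣ ℓ) :
    ¬ (tightCycle r ℓ hℓ.le).IsSidorenko := by
  intro hS
  have h := hS _ (completePartiteKernel_isGraphon r)
  rw [density_tightCycle_completePartiteKernel hr hℓ hdvd] at h
  exact absurd h (not_le.2 (pow_pos (density_singleEdge_completePartiteKernel_pos hr) _))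

/-! ### Double covers and their enumerations -/

theorem mem_cyclicInterval_iff_val_sub_lt {r ℓ : ℕ} (hℓ : r ≤ ℓ) {i v : Fin ℓ} :
    v ∈ cyclicInterval r ℓ i ↔ (v - i).val < r := by
  have hi := i.2
  have hv := v.2
  rw [mem_cyclicInterval, Fin.val_sub]
  constructor
  · rintro ⟨j, hj, hjv⟩
    have : (ℓ - i.val + v.val) % ℓ = j := by
      rw [← hjv, Nat.add_mod_mod, show ℓ - i.val + (i.val + j) = j + ℓ by omega,
        Nat.add_mod_right, Nat.mod_eq_of_lt (by omega)]
    omega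
  · intro h
    refine ⟨_, h, ?_⟩
    rw [Nat.add_mod_mod, show i.val + (ℓ - i.val + v.val) = v.val + ℓ by omega,
      Nat.add_mod_right, Nat.mod_eq_of_lt hv]

theorem cycleDegree_map_addRight {r ℓ : ℕ} [NeZero ℓ] (hℓ : r ≤ ℓ) (F : Finset (Fin ℓ))
    (u v : Fin ℓ) :
    cycleDegree r (F.map (Equiv.addRight u).toEmbedding) (v + u) = cycleDegree r F v := by
  rw [cycleDegree, Finset.filter_map, Finset.card_map, cycleDegree]
  congr 1
  ext i
  simp [mem_cyclicInterval_iff_val_sub_lt hℓ]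

theorem isDoubleCover_map_addRight {r ℓ : ℕ} [NeZero ℓ] (hℓ : r ≤ ℓ) (F : Finset (Fin ℓ))
    (u : Fin ℓ) :
    IsDoubleCover r (F.map (Equiv.addRight u).toEmbedding) ↔ IsDoubleCover r F := by
  constructor
  · intro h v
    rw [← cycleDegree_map_addRight hℓ F u]
    exact h _
  · intro h v
    rw [← sub_add_cancel v u, cycleDegree_map_addRight hℓ]
    exact h _

/-- The set of double covers of the tight cycle that have `m` edges. -/
def doubleCovers (r ℓ m : ℕ) : Finset (Finset (Fin ℓ)) :=
  Finset.univ.filter fun F => IsDoubleCover r F ∧ F.card = m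

/-- The set of double covers of the tight cycle that have `m` edges, one of which starts
at `0`. -/
def basedDoubleCovers (r ℓ m : ℕ) [NeZero ℓ] : Finset (Finset (Fin ℓ)) :=
  (doubleCovers r ℓ m).filter fun F => 0 ∈ F

theorem mem_doubleCovers {r ℓ m : ℕ} {F : Finset (Fin ℓ)} :
    F ∈ doubleCovers r ℓ m ↔ IsDoubleCover r F ∧ F.card = m := by
  simp [doubleCovers]

theorem card_doubleCovers_filter_mem {r ℓ : ℕ} [NeZero ℓ] (hℓ : r ≤ ℓ) (m : ℕ) (v : Fin ℓ) :
    ((doubleCovers r ℓ m).filter fun F => v ∈ F).card = (basedDoubleCovers r ℓ m).card := by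
  symm
  refine Finset.card_bij (fun F _ => F.map (Equiv.addRight v).toEmbedding) ?_ ?_ ?_
  · intro F hF
    simp only [basedDoubleCovers, Finset.mem_filter, mem_doubleCovers] at hF ⊢
    refine ⟨⟨(isDoubleCover_map_addRight hℓ F v).2 hF.1.1, by simpa using hF.1.2⟩, ?_⟩
    simpa using hF.2
  · intro F _ G _ h
    exact Finset.map_injective _ h
  · intro F hF
    simp only [basedDoubleCovers, Finset.mem_filter, mem_doubleCovers] at hF ⊢
    refine ⟨F.map (Equiv.addRight (-v)).toEmbedding, ⟨⟨(isDoubleCover_map_addRight hℓ F _).2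
      hF.1.1, by simpa using hF.1.2⟩, ?_⟩, ?_⟩
    · simpa using hF.2
    · ext w
      simp

/-- By rotation invariance, each vertex starts an edge of the same number of double covers. -/
theorem mul_card_doubleCovers {r ℓ : ℕ} [NeZero ℓ] (hℓ : r ≤ ℓ) (m : ℕ) :
    m * (doubleCovers r ℓ m).card = ℓ * (basedDoubleCovers r ℓ m).card := by
  have h := Finset.sum_card_bipartiteAbove_eq_sum_card_bipartiteBelow
    (s := doubleCovers r ℓ m) (t := (Finset.univ : Finset (Fin ℓ))) (fun F v => v ∈ F)
  have h1 : ∀ F ∈ doubleCovers r ℓ m, (Finset.univ.bipartiteAbove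
      (fun (F : Finset (Fin ℓ)) v => v ∈ F) F).card = m := by
    intro F hF
    rw [Finset.bipartiteAbove, Finset.filter_univ_mem]
    exact (mem_doubleCovers.1 hF).2
  have h2 : ∀ v ∈ (Finset.univ : Finset (Fin ℓ)), ((doubleCovers r ℓ m).bipartiteBelow
      (fun (F : Finset (Fin ℓ)) v => v ∈ F) v).card = (basedDoubleCovers r ℓ m).card :=
    fun v _ => card_doubleCovers_filter_mem hℓ m v
  rw [Finset.sum_congr rfl h1, Finset.sum_congr rfl h2] at h
  simpa [mul_comm] using h

section Enum

variable {ℓ : ℕ} [NeZero ℓ]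

/-- The increasing enumeration of the natural numbers whose residue modulo `ℓ` lies in `F`. -/
noncomputable def cyclicEnum (F : Finset (Fin ℓ)) : ℕ → ℕ :=
  Nat.nth fun x => Fin.ofNat ℓ x ∈ F

variable {F : Finset (Fin ℓ)}

theorem ofNat_add_self (x : ℕ) : Fin.ofNat ℓ (x + ℓ) = Fin.ofNat ℓ x := by
  ext
  simp

theorem ofNat_val_self (i : Fin ℓ) : Fin.ofNat ℓ i.val = i := by
  ext
  simp

theorem infinite_setOf_ofNat_mem (hF : F.Nonempty) :
    {x : ℕ | Fin.ofNat ℓ x ∈ F}.Infinite := by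
  obtain ⟨i, hi⟩ := hF
  have hℓ : 0 < ℓ := Nat.pos_of_neZero ℓ
  refine Set.infinite_of_injective_forall_mem (f := fun n : ℕ => i.val + ℓ * n) ?_ ?_
  · intro a b hab
    exact Nat.eq_of_mul_eq_mul_left hℓ (Nat.add_left_cancel hab)
  · intro n
    have : Fin.ofNat ℓ (i.val + ℓ * n) = i := by
      ext
      simp [Nat.mod_eq_of_lt i.2]
    rw [Set.mem_ofPred_eq, this]
    exact hi

theorem cyclicEnum_strictMono (hF : F.Nonempty) : StrictMono (cyclicEnum F) :=
  Nat.nth_strictMono (infinite_setOf_ofNat_mem hF)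

theorem ofNat_cyclicEnum_mem (hF : F.Nonempty) (n : ℕ) : Fin.ofNat ℓ (cyclicEnum F n) ∈ F :=
  Nat.nth_mem_of_infinite (infinite_setOf_ofNat_mem hF) n

theorem range_cyclicEnum (hF : F.Nonempty) :
    Set.range (cyclicEnum F) = {x : ℕ | Fin.ofNat ℓ x ∈ F} :=
  Nat.range_nth_of_infinite (infinite_setOf_ofNat_mem hF)

theorem cyclicEnum_zero (h0 : 0 ∈ F) : cyclicEnum F 0 = 0 :=
  Nat.nth_zero_of_zero (by simpa using h0)

theorem count_cyclicEnum (hF : F.Nonempty) (n : ℕ) :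
    Nat.count (fun x => Fin.ofNat ℓ x ∈ F) (cyclicEnum F n) = n :=
  Nat.count_nth_of_infinite (infinite_setOf_ofNat_mem hF) n

theorem count_ofNat_mem (F : Finset (Fin ℓ)) :
    Nat.count (fun x => Fin.ofNat ℓ x ∈ F) ℓ = F.card := by
  rw [Nat.count_eq_card_filter_range]
  refine Finset.card_bij (fun x _ => Fin.ofNat ℓ x) ?_ ?_ ?_
  · intro x hx
    exact (Finset.mem_filter.1 hx).2
  · intro x hx y hy hxy
    have hx' := Finset.mem_range.1 (Finset.mem_filter.1 hx).1
    have hy' := Finset.mem_range.1 (Finset.mem_filter.1 hy).1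
    have h := congrArg Fin.val hxy
    simpa [Nat.mod_eq_of_lt hx', Nat.mod_eq_of_lt hy'] using h
  · intro i hi
    refine ⟨i.val, Finset.mem_filter.2 ⟨Finset.mem_range.2 i.2, ?_⟩, ofNat_val_self i⟩
    rwa [ofNat_val_self]

theorem cyclicEnum_add_card (hF : F.Nonempty) (n : ℕ) :
    cyclicEnum F (n + F.card) = cyclicEnum F n + ℓ := by
  have h1 : Nat.count (fun x => Fin.ofNat ℓ x ∈ F) (cyclicEnum F n + ℓ) = n + F.card := by
    rw [add_comm _ ℓ, Nat.count_add, count_ofNat_mem]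
    simp only [add_comm ℓ, ofNat_add_self]
    rw [count_cyclicEnum hF, add_comm]
  rw [← h1]
  refine Nat.nth_count (p := fun x => Fin.ofNat ℓ x ∈ F) ?_
  rw [ofNat_add_self]
  exact ofNat_cyclicEnum_mem hF n

theorem cyclicEnum_injOn {F G : Finset (Fin ℓ)} (hF : F.Nonempty) (hG : G.Nonempty)
    (h : cyclicEnum F = cyclicEnum G) : F = G := by
  have h1 : {x : ℕ | Fin.ofNat ℓ x ∈ F} = {x : ℕ | Fin.ofNat ℓ x ∈ G} := by
    rw [← range_cyclicEnum hF, ← range_cyclicEnum hG, h]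
  ext i
  have := Set.ext_iff.1 h1 i.val
  simpa only [Set.mem_ofPred_eq, ofNat_val_self] using this

/-- The degree of the vertex `n + r` counts the members of `F` among `n + 1, …, n + r`. -/
theorem count_add_cycleDegree {r : ℕ} (hr : r ≤ ℓ) (F : Finset (Fin ℓ)) (n : ℕ) :
    Nat.count (fun x => Fin.ofNat ℓ x ∈ F) (n + 1 + r) =
      Nat.count (fun x => Fin.ofNat ℓ x ∈ F) (n + 1) +
        cycleDegree r F (Fin.ofNat ℓ (n + r)) := by
  rw [Nat.count_add]
  congr 1
  rw [Nat.count_eq_card_filter_range, cycleDegree]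
  have hval : ∀ i < r, (Fin.ofNat ℓ (n + 1 + i)).val + (r - 1 - i) ≡ n + r [MOD ℓ] := by
    intro i hi
    have : (Fin.ofNat ℓ (n + 1 + i)).val ≡ n + 1 + i [MOD ℓ] := Nat.mod_modEq _ _
    have h2 := this.add_right (r - 1 - i)
    rwa [show n + 1 + i + (r - 1 - i) = n + r by omega] at h2
  refine Finset.card_bij (fun j _ => Fin.ofNat ℓ (n + 1 + j)) ?_ ?_ ?_
  · intro j hj
    obtain ⟨hj1, hj2⟩ := Finset.mem_filter.1 hj
    have hj1 := Finset.mem_range.1 hj1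
    exact Finset.mem_filter.2 ⟨hj2, mem_cyclicInterval.2 ⟨r - 1 - j, by omega, hval j hj1⟩⟩
  · intro i hi j hj hij
    have hi1 := Finset.mem_range.1 (Finset.mem_filter.1 hi).1
    have hj1 := Finset.mem_range.1 (Finset.mem_filter.1 hj).1
    have h3 : n + 1 + i ≡ n + 1 + j [MOD ℓ] := congrArg Fin.val hij
    exact (Nat.ModEq.add_left_cancel' _ h3).eq_of_lt_of_lt (by omega) (by omega)
  · intro i hi
    obtain ⟨hiF, hi2⟩ := Finset.mem_filter.1 hi
    obtain ⟨s, hs, hsi⟩ := mem_cyclicInterval.1 hi2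
    have hsi' : i.val + s ≡ n + r [MOD ℓ] := hsi
    have h4 : Fin.ofNat ℓ (n + 1 + (r - 1 - s)) = i := by
      have h5 : n + 1 + (r - 1 - s) ≡ i.val [MOD ℓ] := by
        refine Nat.ModEq.add_right_cancel' s ?_
        rw [show n + 1 + (r - 1 - s) + s = n + r by omega]
        exact hsi'.symm
      ext
      have h6 : (n + 1 + (r - 1 - s)) % ℓ = i.val % ℓ := h5
      rw [Nat.mod_eq_of_lt i.2] at h6
      simpa using h6
    refine ⟨r - 1 - s, Finset.mem_filter.2 ⟨Finset.mem_range.2 (by omega), ?_⟩, h4⟩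
    rwa [h4]

theorem cyclicEnum_add_two_le {r : ℕ} (hr : r ≤ ℓ) (hF : F.Nonempty) (hc : IsDoubleCover r F)
    (n : ℕ) : cyclicEnum F (n + 2) ≤ cyclicEnum F n + r := by
  have h := count_add_cycleDegree hr F (cyclicEnum F n)
  have h1 : Nat.count (fun x => Fin.ofNat ℓ x ∈ F) (cyclicEnum F n + 1) = n + 1 := by
    rw [Nat.count_succ, count_cyclicEnum hF, if_pos (ofNat_cyclicEnum_mem hF n)]
  have h2 := hc (Fin.ofNat ℓ (cyclicEnum F n + r))
  have h3 : cyclicEnum F (n + 2) < cyclicEnum F n + 1 + r :=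
    Nat.nth_lt_of_lt_count (by omega)
  omega

/-- The set of residues modulo `ℓ` of the values of a sequence. -/
def residueSet (ℓ : ℕ) [NeZero ℓ] (m : ℕ) (a : ℕ → ℕ) : Finset (Fin ℓ) :=
  (Finset.range m).image fun n => Fin.ofNat ℓ (a n)

/-- A strictly increasing sequence `a` with `a₀ = 0`, `aₙ₊ₘ = aₙ + ℓ` and `aₙ₊₂ ≤ aₙ + r` arises
from a double cover with `m` edges. -/
theorem residueSet_spec {r m : ℕ} (hr : r ≤ ℓ) (hm : 0 < m) {a : ℕ → ℕ} (hmono : StrictMono a)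
    (h0 : a 0 = 0) (hper : ∀ n, a (n + m) = a n + ℓ) (hr2 : ∀ n, a (n + 2) ≤ a n + r) :
    residueSet ℓ m a ∈ basedDoubleCovers r ℓ m ∧ cyclicEnum (residueSet ℓ m a) = a := by
  set F := residueSet ℓ m a with hFdef
  have h0F : (0 : Fin ℓ) ∈ F := by
    refine Finset.mem_image.2 ⟨0, Finset.mem_range.2 hm, ?_⟩
    simp [h0]
  have hne : F.Nonempty := ⟨0, h0F⟩
  have hper' : ∀ n q, a (n + m * q) = a n + ℓ * q := by
    intro n q
    induction q with
    | zero => simp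
    | succ q ih => rw [Nat.mul_succ, ← add_assoc, hper, ih, Nat.mul_succ, add_assoc]
  have hrange : Set.range a = {x : ℕ | Fin.ofNat ℓ x ∈ F} := by
    ext x
    simp only [Set.mem_range, Set.mem_ofPred_eq]
    constructor
    · rintro ⟨n, rfl⟩
      refine Finset.mem_image.2 ⟨n % m, Finset.mem_range.2 (Nat.mod_lt _ hm), ?_⟩
      have := hper' (n % m) (n / m)
      rw [Nat.mod_add_div] at this
      ext
      simp [this]
    · intro hx
      obtain ⟨n, hn, hnx⟩ := Finset.mem_image.1 hx
      have hn := Finset.mem_range.1 hn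
      have hlt : a n < ℓ := by
        have := hmono hn
        have h1 := hper 0
        rw [h0, zero_add, zero_add] at h1
        omega
      refine ⟨n + m * (x / ℓ), ?_⟩
      have h2 : a n % ℓ = x % ℓ := congrArg Fin.val hnx
      rw [Nat.mod_eq_of_lt hlt] at h2
      rw [hper', h2, Nat.mod_add_div]
  have hEq : cyclicEnum F = a := by
    rw [← StrictMono.range_inj (cyclicEnum_strictMono hne) hmono, range_cyclicEnum hne, hrange]
  refine ⟨?_, hEq⟩
  rw [basedDoubleCovers, Finset.mem_filter, mem_doubleCovers]
  refine ⟨⟨?_, ?_⟩, h0F⟩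
  · intro v
    -- Compare the last value of `a` before the window ending in `v` with its second successor.
    obtain ⟨n, hn⟩ : ∃ n, Fin.ofNat ℓ (n + r) = v := by
      refine ⟨v.val + ℓ - r, ?_⟩
      rw [show v.val + ℓ - r + r = v.val + ℓ by omega, ofNat_add_self, ofNat_val_self]
    have hcount := count_add_cycleDegree hr F n
    rw [hn] at hcount
    set i := Nat.count (fun x => Fin.ofNat ℓ x ∈ F) (n + 1) with hi
    have hi1 : 1 ≤ i := by
      rw [hi]
      have h1 : Nat.count (fun x => Fin.ofNat ℓ x ∈ F) 1 = 1 := by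
        rw [Nat.count_succ]
        simp [h0F]
      calc 1 = Nat.count (fun x => Fin.ofNat ℓ x ∈ F) 1 := h1.symm
        _ ≤ _ := Nat.count_monotone _ (by omega)
    have h1 : cyclicEnum F (i - 1) < n + 1 := Nat.nth_lt_of_lt_count (by omega)
    have h2 := hr2 (i - 1)
    rw [hEq] at h1
    have h3 : a (i - 1 + 2) < n + 1 + r := by omega
    have h4 : i - 1 + 2 < Nat.count (fun x => Fin.ofNat ℓ x ∈ F) (n + 1 + r) := by
      have := Nat.count_strict_mono (p := fun x => Fin.ofNat ℓ x ∈ F)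
        (ofNat_cyclicEnum_mem hne (i - 1 + 2)) (hEq ▸ h3)
      rwa [count_cyclicEnum hne] at this
    omega
  · have h1 := count_cyclicEnum hne m
    have h2 := hper 0
    rw [h0, zero_add, zero_add] at h2
    rw [hEq, h2, count_ofNat_mem] at h1
    exact h1

/-- The sequences enumerating the based double covers with `m` edges. -/
theorem cyclicEnum_spec {r m : ℕ} (hr : r ≤ ℓ) (hF : F ∈ basedDoubleCovers r ℓ m) :
    StrictMono (cyclicEnum F) ∧ cyclicEnum F 0 = 0 ∧
      (∀ n, cyclicEnum F (n + m) = cyclicEnum F n + ℓ) ∧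
      ∀ n, cyclicEnum F (n + 2) ≤ cyclicEnum F n + r := by
  rw [basedDoubleCovers, Finset.mem_filter, mem_doubleCovers] at hF
  obtain ⟨⟨hc, rfl⟩, h0⟩ := hF
  have hne : F.Nonempty := ⟨0, h0⟩
  exact ⟨cyclicEnum_strictMono hne, cyclicEnum_zero h0, cyclicEnum_add_card hne,
    cyclicEnum_add_two_le hr hne hc⟩

end Enum

/-! ### Counting double covers of a given even size -/

theorem card_piAntidiag_nat {ι : Type*} [DecidableEq ι] (s : Finset ι) (n : ℕ) :
    (s.piAntidiag n).card = (s.card + n - 1).choose n := by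
  rw [← Finset.card_finsuppAntidiag_nat_eq_choose]
  symm
  refine Finset.card_bij (fun f _ => f) ?_ ?_ ?_
  · intro f hf
    rw [Finset.mem_finsuppAntidiag] at hf
    exact Finset.mem_piAntidiag.2 ⟨hf.1, fun i hi => hf.2 (Finsupp.mem_support_iff.2 hi)⟩
  · intro f _ g _ h
    exact DFunLike.coe_injective h
  · intro f hf
    obtain ⟨h1, h2⟩ := Finset.mem_piAntidiag.1 hf
    refine ⟨Finsupp.onFinset s f h2, Finset.mem_finsuppAntidiag.2 ⟨by simpa using h1, ?_⟩, ?_⟩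
    · exact Finsupp.support_onFinset_subset
    · ext i
      simp

section Even

variable {r k q : ℕ}

/-- A sequence with `aₙ₊ₘ = aₙ + ℓ` is determined by its first `m` terms. -/
theorem cyclic_seq_ext {ℓ m : ℕ} (hm : 0 < m) {a b : ℕ → ℕ} (ha : ∀ n, a (n + m) = a n + ℓ)
    (hb : ∀ n, b (n + m) = b n + ℓ) (h : ∀ n < m, a n = b n) : a = b := by
  funext n
  induction n using Nat.strong_induction_on with
  | _ n ih =>
    rcases Nat.lt_or_ge n m with hn | hn
    · exact h n hn
    · obtain ⟨i, rfl⟩ := Nat.exists_eq_add_of_le' hn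
      rw [ha, hb, ih i (by omega)]

/-- The amounts by which the two-step increments of a sequence, starting at the terms of parity
`s`, fall short of `r`. -/
def twoStepDefect (r q s : ℕ) (a : ℕ → ℕ) (j : ℕ) : ℕ :=
  if j < q then a (2 * j + s) + r - a (2 * j + s + 2) else 0

theorem sum_twoStepDefect {s : ℕ} {a : ℕ → ℕ} (h2 : ∀ n, a (n + 2) ≤ a n + r) {n : ℕ}
    (hn : n ≤ q) :
    ∑ j ∈ Finset.range n, twoStepDefect r q s a j + a (2 * n + s) = r * n + a s := by
  induction n with
  | zero => simp
  | succ n ih =>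
    have h1 := h2 (2 * n + s)
    have h3 := ih (by omega)
    rw [Finset.sum_range_succ, twoStepDefect, if_pos (by omega),
      show 2 * (n + 1) + s = 2 * n + s + 2 by ring, Nat.mul_succ]
    omega

/-- In a based double cover with an even number of edges, the terms of even index and those of odd
index of the enumeration have increments at most `r`. Both families of defects are compositions of
the same number, and together with the first positive term they determine the cover. -/
theorem card_basedDoubleCovers_even_le [NeZero (r * k)] (hr : r ≤ r * k)
    (hq : 0 < q) : (basedDoubleCovers r (r * k) (2 * q)).card ≤
      (r - 1) * ((q + r * (q - k) - 1).choose (r * (q - k))) ^ 2 := by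
  have hcard : ((Finset.Icc 1 (r - 1)) ×ˢ ((Finset.range q).piAntidiag (r * (q - k)) ×ˢ
      (Finset.range q).piAntidiag (r * (q - k)))).card =
      (r - 1) * ((q + r * (q - k) - 1).choose (r * (q - k))) ^ 2 := by
    rw [Finset.card_product, Finset.card_product, card_piAntidiag_nat]
    simp [sq]
  rw [← hcard]
  refine Finset.card_le_card_of_injOn (fun F => (cyclicEnum F 1,
    twoStepDefect r q 0 (cyclicEnum F), twoStepDefect r q 1 (cyclicEnum F))) ?_ ?_
  · intro F hF
    obtain ⟨hmono, h0, hper, h2⟩ := cyclicEnum_spec hr hF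
    set a := cyclicEnum F
    have hsum : ∀ s, ∑ j ∈ Finset.range q, twoStepDefect r q s a j = r * (q - k) := by
      intro s
      have h3 := sum_twoStepDefect (q := q) (s := s) h2 le_rfl
      rw [add_comm (2 * q), hper] at h3
      rw [Nat.mul_sub]
      omega
    have hsupp : ∀ s j, twoStepDefect r q s a j ≠ 0 → j ∈ Finset.range q := by
      intro s j hj
      by_contra hjq
      rw [Finset.mem_range] at hjq
      simp [twoStepDefect, hjq] at hj
    have h4 := hmono (show 0 < 1 by norm_num)
    have h5 := hmono (show 1 < 2 by norm_num)
    have h6 : a 2 ≤ a 0 + r := h2 0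
    simp only [Finset.coe_product, Set.mem_prod, Finset.mem_coe, Finset.mem_Icc,
      Finset.mem_piAntidiag]
    refine ⟨⟨?_, ?_⟩, ⟨hsum 0, hsupp 0⟩, hsum 1, hsupp 1⟩ <;> simp only [a] at * <;> omega
  · intro F hF G hG hFG
    obtain ⟨-, h0, hper, h2⟩ := cyclicEnum_spec hr hF
    obtain ⟨-, h0', hper', h2'⟩ := cyclicEnum_spec hr hG
    simp only [Prod.mk.injEq] at hFG
    obtain ⟨hu, he, hf⟩ := hFG
    have hF0 : F.Nonempty := ⟨0, (Finset.mem_filter.1 hF).2⟩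
    have hG0 : G.Nonempty := ⟨0, (Finset.mem_filter.1 hG).2⟩
    refine cyclicEnum_injOn hF0 hG0 (cyclic_seq_ext (by omega) hper hper' fun n hn => ?_)
    obtain ⟨j, rfl | rfl⟩ := Nat.even_or_odd' n
    · have h3 := sum_twoStepDefect (q := q) (s := 0) h2 (n := j) (by omega)
      have h4 := sum_twoStepDefect (q := q) (s := 0) h2' (n := j) (by omega)
      rw [he] at h3
      simp only [add_zero] at h3 h4
      omega
    · have h3 := sum_twoStepDefect (q := q) (s := 1) h2 (n := j) (by omega)
      have h4 := sum_twoStepDefect (q := q) (s := 1) h2' (n := j) (by omega)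
      rw [hf] at h3
      omega

/-- A double cover has at least `2k` edges. -/
theorem doubleCovers_even_eq_empty [NeZero (r * k)] (hr : r ≤ r * k) (hr0 : 0 < r) (hk : q < k) :
    doubleCovers r (r * k) (2 * q) = ∅ := by
  have hb : basedDoubleCovers r (r * k) (2 * q) = ∅ := by
    rw [Finset.eq_empty_iff_forall_notMem]
    intro F hF
    obtain ⟨-, h0, hper, h2⟩ := cyclicEnum_spec hr hF
    have h3 := sum_twoStepDefect (q := q) (s := 0) h2 le_rfl
    have h4 := hper 0
    simp only [h0, zero_add, add_zero] at h3 h4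
    rw [h4] at h3
    have h5 : r * k ≤ r * q := by omega
    exact absurd (Nat.le_of_mul_le_mul_left h5 hr0) (by omega)
  have h := mul_card_doubleCovers hr (2 * q)
  rw [hb, Finset.card_empty, mul_zero, Nat.mul_eq_zero] at h
  rcases h with h | h
  · have hq0 : q = 0 := by omega
    subst hq0
    rw [Finset.eq_empty_iff_forall_notMem]
    intro F hF
    obtain ⟨hc, hF0⟩ := mem_doubleCovers.1 hF
    rw [mul_zero, Finset.card_eq_zero] at hF0
    subst hF0
    have := hc 0
    simp [cycleDegree] at this
  · exact Finset.card_eq_zero.1 h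

end Even

/-! ### Counting double covers with `2k + 1` edges -/

section Odd

variable {r k : ℕ}

/-- The sequence that interleaves `b` with a shifted copy of itself. -/
def interleave (r k : ℕ) (b : ℕ → ℕ) (n : ℕ) : ℕ :=
  if Even n then b (n / 2) else b (n / 2 + k + 1) - r * k

theorem interleave_even (b : ℕ → ℕ) (j : ℕ) : interleave r k b (2 * j) = b j := by
  simp [interleave]

theorem interleave_odd (b : ℕ → ℕ) (j : ℕ) :
    interleave r k b (2 * j + 1) = b (j + k + 1) - r * k := by
  have h : ¬ Even (2 * j + 1) := by simp [parity_simps]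
  rw [interleave, if_neg h, show (2 * j + 1) / 2 = j by omega]

/-- If each step of `b` is at most `r`, any `k + 1` steps together exceed `r k`, and `2k + 1` steps
make `2 r k`, then interleaving `b` with its shift gives the enumeration of a double cover. -/
theorem interleave_spec {b : ℕ → ℕ} (hstep : ∀ n, b (n + 1) ≤ b n + r)
    (hper : ∀ n, b (n + (2 * k + 1)) = b n + 2 * (r * k))
    (hgap : ∀ n, b n + r * k < b (n + k + 1)) :
    StrictMono (interleave r k b) ∧
      (∀ n, interleave r k b (n + (2 * k + 1)) = interleave r k b n + r * k) ∧
      ∀ n, interleave r k b (n + 2) ≤ interleave r k b n + r := by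
  refine ⟨strictMono_nat_of_lt_succ fun n => ?_, fun n => ?_, fun n => ?_⟩
  · obtain ⟨j, rfl | rfl⟩ := Nat.even_or_odd' n
    · rw [interleave_even, interleave_odd]
      have := hgap j
      omega
    · rw [interleave_odd, show 2 * j + 1 + 1 = 2 * (j + 1) by ring, interleave_even]
      have h0 := hgap j
      have h1 := hgap (j + k + 1)
      have h2 := hper (j + 1)
      rw [show j + 1 + (2 * k + 1) = j + k + 1 + k + 1 by ring] at h2
      omega
  · obtain ⟨j, rfl | rfl⟩ := Nat.even_or_odd' n
    · rw [interleave_even, show 2 * j + (2 * k + 1) = 2 * (j + k) + 1 by ring, interleave_odd]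
      have h2 := hper j
      rw [show j + k + k + 1 = j + (2 * k + 1) by ring]
      omega
    · rw [interleave_odd, show 2 * j + 1 + (2 * k + 1) = 2 * (j + k + 1) by ring,
        interleave_even]
      have := hgap j
      omega
  · obtain ⟨j, rfl | rfl⟩ := Nat.even_or_odd' n
    · rw [interleave_even, show 2 * j + 2 = 2 * (j + 1) by ring, interleave_even]
      exact hstep j
    · rw [interleave_odd, show 2 * j + 1 + 2 = 2 * (j + 1) + 1 by ring, interleave_odd]
      have h1 := hstep (j + k + 1)
      have h2 := hgap j
      rw [show j + 1 + k + 1 = j + k + 1 + 1 by ring]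
      omega

/-- The partial sums of `r - e (i mod m)`. -/
def defectSum (r m : ℕ) (e : ℕ → ℕ) (n : ℕ) : ℕ :=
  ∑ i ∈ Finset.range n, (r - e (i % m))

/-- The compositions of `r` into `2k + 1` cyclically arranged parts, possibly zero, for which
no `k + 1` consecutive parts exhaust `r`. -/
def spreadCompositions (r k : ℕ) : Finset (ℕ → ℕ) :=
  ((Finset.range (2 * k + 1)).piAntidiag r).filter fun e =>
    ∀ j < 2 * k + 1, ∑ i ∈ Finset.range (k + 1), e ((j + i) % (2 * k + 1)) < r

theorem defectSum_add (r m : ℕ) (e : ℕ → ℕ) (hle : ∀ i, e (i % m) ≤ r) (n s : ℕ) :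
    defectSum r m e (n + s) + ∑ i ∈ Finset.range s, e ((n + i) % m) =
      defectSum r m e n + r * s := by
  induction s with
  | zero => simp
  | succ s ih =>
    have h := hle (n + s)
    rw [← add_assoc, Finset.sum_range_succ, Nat.mul_succ, defectSum, Finset.sum_range_succ]
    rw [defectSum] at ih
    omega

theorem sum_range_mod_eq {m : ℕ} (hm : 0 < m) (e : ℕ → ℕ) (n : ℕ) :
    ∑ i ∈ Finset.range m, e ((n + i) % m) = ∑ i ∈ Finset.range m, e i := by
  refine Finset.sum_nbij (fun i => (n + i) % m) ?_ ?_ ?_ ?_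
  · intro i _
    exact Finset.mem_range.2 (Nat.mod_lt _ hm)
  · intro i hi j hj hij
    exact (Nat.ModEq.add_left_cancel' n hij).eq_of_lt_of_lt (by simpa using hi) (by simpa using hj)
  · refine Finset.surjOn_of_injOn_of_card_le _ ?_ ?_ le_rfl
    · intro i _
      exact Finset.mem_range.2 (Nat.mod_lt _ hm)
    · intro i hi j hj hij
      exact (Nat.ModEq.add_left_cancel' n hij).eq_of_lt_of_lt (by simpa using hi)
        (by simpa using hj)
  · intros
    rfl

/-- A spread composition `e` gives the double cover whose enumeration `a` has the two-step
increments `r - e`: as `2k + 1` is odd, steps of two visit all terms of the cyclic sequence. -/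
theorem card_spreadCompositions_le [NeZero (r * k)] (hr : r ≤ r * k) :
    (spreadCompositions r k).card ≤ (basedDoubleCovers r (r * k) (2 * k + 1)).card := by
  have key : ∀ e ∈ spreadCompositions r k, (∀ i, e (i % (2 * k + 1)) ≤ r) ∧
      residueSet (r * k) (2 * k + 1) (interleave r k (defectSum r (2 * k + 1) e)) ∈
        basedDoubleCovers r (r * k) (2 * k + 1) ∧
      cyclicEnum (residueSet (r * k) (2 * k + 1)
        (interleave r k (defectSum r (2 * k + 1) e))) =
          interleave r k (defectSum r (2 * k + 1) e) := by
    intro e he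
    obtain ⟨he1, he2⟩ := Finset.mem_filter.1 he
    obtain ⟨hsum, -⟩ := Finset.mem_piAntidiag.1 he1
    have hle : ∀ i, e (i % (2 * k + 1)) ≤ r := by
      intro i
      rw [← hsum]
      exact Finset.single_le_sum (f := e) (fun _ _ => Nat.zero_le _)
        (Finset.mem_range.2 (Nat.mod_lt _ (by omega)))
    have hadd := defectSum_add r (2 * k + 1) e hle
    set b := defectSum r (2 * k + 1) e with hb
    have hstep : ∀ n, b (n + 1) ≤ b n + r := by
      intro n
      have := hadd n 1
      omega
    have hper : ∀ n, b (n + (2 * k + 1)) = b n + 2 * (r * k) := by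
      intro n
      have h1 := hadd n (2 * k + 1)
      rw [sum_range_mod_eq (by omega), hsum] at h1
      have h2 : r * (2 * k + 1) = 2 * (r * k) + r := by ring
      omega
    have hgap : ∀ n, b n + r * k < b (n + k + 1) := by
      intro n
      have h1 := hadd n (k + 1)
      have h2 := he2 (n % (2 * k + 1)) (Nat.mod_lt _ (by omega))
      simp only [Nat.mod_add_mod] at h2
      rw [← add_assoc, Nat.mul_succ] at h1
      omega
    obtain ⟨h1, h2, h3⟩ := interleave_spec hstep hper hgap
    have h0 : interleave r k b 0 = 0 := by
      rw [show 0 = 2 * 0 by rfl, interleave_even, hb]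
      simp [defectSum]
    exact ⟨hle, residueSet_spec hr (by omega) h1 h0 h2 h3⟩
  refine Finset.card_le_card_of_injOn
    (fun e => residueSet (r * k) (2 * k + 1) (interleave r k (defectSum r (2 * k + 1) e)))
    (fun e he => (key e he).2.1) ?_
  intro e he e' he' hee
  obtain ⟨hle, -, hE⟩ := key e he
  obtain ⟨hle', -, hE'⟩ := key e' he'
  have hI : interleave r k (defectSum r (2 * k + 1) e) =
      interleave r k (defectSum r (2 * k + 1) e') := by
    rw [← hE, ← hE']
    exact congrArg cyclicEnum hee
  have hD : ∀ n, defectSum r (2 * k + 1) e n = defectSum r (2 * k + 1) e' n := by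
    intro n
    rw [← interleave_even (r := r) (k := k) (defectSum r (2 * k + 1) e), hI, interleave_even]
  funext n
  rcases Nat.lt_or_ge n (2 * k + 1) with hn | hn
  · have h1 := defectSum_add r (2 * k + 1) e hle n 1
    have h2 := defectSum_add r (2 * k + 1) e' hle' n 1
    rw [hD, hD] at h1
    simp [Nat.mod_eq_of_lt hn] at h1 h2
    omega
  · have hz : ∀ f ∈ spreadCompositions r k, f n = 0 := by
      intro f hf
      by_contra h
      have := (Finset.mem_piAntidiag.1 (Finset.mem_filter.1 hf).1).2 n h
      rw [Finset.mem_range] at this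
      omega
    rw [hz e he, hz e' he']

/-- A composition that is not spread vanishes outside an arc of `k + 1` positions, which may be
taken to start with a positive part. -/
theorem choose_le_card_spreadCompositions (hr : 0 < r) :
    (2 * k + r).choose r ≤ (spreadCompositions r k).card +
      (2 * k + 1) * (k + r - 1).choose (r - 1) := by
  classical
  set m := 2 * k + 1 with hm
  have hm0 : 0 < m := by omega
  let arc : ℕ → Finset ℕ := fun j => (Finset.range (k + 1)).image fun i => (j + i) % m
  have harc : ∀ j, (arc j).card = k + 1 := by
    intro j
    rw [Finset.card_image_of_injOn, Finset.card_range]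
    intro a ha b hb hab
    have ha' : a < k + 1 := by simpa using ha
    have hb' : b < k + 1 := by simpa using hb
    exact (Nat.ModEq.add_left_cancel' j hab).eq_of_lt_of_lt (by omega) (by omega)
  let B : ℕ → Finset (ℕ → ℕ) := fun j =>
    ((arc j).piAntidiag (r - 1)).image fun e => e + Pi.single j 1
  have hB : ∀ j, (B j).card ≤ (k + r - 1).choose (r - 1) := by
    intro j
    refine Finset.card_image_le.trans (le_of_eq ?_)
    rw [card_piAntidiag_nat, harc, show k + 1 + (r - 1) - 1 = k + r - 1 by omega]
  have hsub : (Finset.range m).piAntidiag r ⊆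
      spreadCompositions r k ∪ (Finset.range m).biUnion B := by
    intro e he
    by_cases hg : e ∈ spreadCompositions r k
    · exact Finset.mem_union_left _ hg
    refine Finset.mem_union_right _ (Finset.mem_biUnion.2 ?_)
    obtain ⟨hsum, hsupp⟩ := Finset.mem_piAntidiag.1 he
    have hbad : ∃ j < m, r ≤ ∑ i ∈ Finset.range (k + 1), e ((j + i) % m) := by
      by_contra! h
      exact hg (Finset.mem_filter.2 ⟨he, h⟩)
    obtain ⟨j, hj, hjr⟩ := hbad
    -- `s` is the offset of the first positive part in the arc starting at `j`.
    have hex : ∃ s, s < k + 1 ∧ e ((j + s) % m) ≠ 0 := by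
      by_contra! h
      rw [Finset.sum_eq_zero fun i hi => h i (Finset.mem_range.1 hi)] at hjr
      omega
    let s := Nat.find hex
    obtain ⟨hs1, hs2⟩ : s < k + 1 ∧ e ((j + s) % m) ≠ 0 := Nat.find_spec hex
    have hs3 : ∀ i < s, e ((j + i) % m) = 0 := by
      intro i hi
      have h := Nat.find_min hex hi
      by_contra h'
      exact h ⟨by omega, h'⟩
    have hout : ∀ i, k + 1 ≤ i → i < m → e ((j + i) % m) = 0 := by
      have h1 := sum_range_mod_eq hm0 e j
      rw [hsum, ← Finset.sum_range_add_sum_Ico _ (show k + 1 ≤ m by omega)] at h1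
      have h2 : ∑ i ∈ Finset.Ico (k + 1) m, e ((j + i) % m) = 0 := by omega
      intro i hi him
      exact Finset.sum_eq_zero_iff.1 h2 i (Finset.mem_Ico.2 ⟨hi, him⟩)
    have hsupp' : ∀ n, e n ≠ 0 → n ∈ arc ((j + s) % m) := by
      intro n hn
      have hnm := Finset.mem_range.1 (hsupp n hn)
      obtain ⟨i, him, hin⟩ : ∃ i < m, (j + i) % m = n := by
        refine ⟨(m - j + n) % m, Nat.mod_lt _ hm0, ?_⟩
        rw [Nat.add_mod_mod, show j + (m - j + n) = n + m by omega, Nat.add_mod_right,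
          Nat.mod_eq_of_lt hnm]
      rw [← hin] at hn
      have hi1 : i < k + 1 := by
        by_contra h
        exact hn (hout i (by omega) him)
      have hi2 : s ≤ i := by
        by_contra h
        exact hn (hs3 i (by omega))
      refine Finset.mem_image.2 ⟨i - s, Finset.mem_range.2 (by omega), ?_⟩
      rw [Nat.mod_add_mod, show j + s + (i - s) = j + i by omega, hin]
    have hpos : 1 ≤ e ((j + s) % m) := by omega
    have hsplit : e - Pi.single ((j + s) % m) 1 + Pi.single ((j + s) % m) 1 = e := by
      funext n
      by_cases hn : n = (j + s) % m
      · subst hn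
        simp only [Pi.add_apply, Pi.sub_apply, Pi.single_eq_same]
        omega
      · simp [Pi.single_eq_of_ne hn]
    refine ⟨(j + s) % m, Finset.mem_range.2 (Nat.mod_lt _ hm0), Finset.mem_image.2
      ⟨e - Pi.single ((j + s) % m) 1, Finset.mem_piAntidiag.2 ⟨?_, ?_⟩, hsplit⟩⟩
    · have hmem : (j + s) % m ∈ arc ((j + s) % m) := hsupp' _ (by omega)
      have h1 : ∑ n ∈ arc ((j + s) % m), e n = r := by
        rw [← hsum]
        refine Finset.sum_subset_zero_on_sdiff ?_ ?_ fun _ _ => rfl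
        · intro n hn
          obtain ⟨i, -, rfl⟩ := Finset.mem_image.1 hn
          exact Finset.mem_range.2 (Nat.mod_lt _ hm0)
        · intro n hn
          by_contra h
          exact (Finset.mem_sdiff.1 hn).2 (hsupp' n h)
      have h2 : (arc ((j + s) % m)).sum (e - Pi.single ((j + s) % m) 1 : ℕ → ℕ) + 1 = r := by
        rw [← h1]
        conv_rhs => rw [← hsplit]
        simp only [Pi.add_apply]
        rw [Finset.sum_add_distrib, Finset.sum_pi_single', if_pos hmem]
      omega
    · intro n hn
      refine hsupp' n fun h => hn ?_
      simp [h]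
  calc (2 * k + r).choose r = ((Finset.range m).piAntidiag r).card := by
        rw [card_piAntidiag_nat, Finset.card_range, hm, show 2 * k + 1 + r - 1 = 2 * k + r by omega]
    _ ≤ (spreadCompositions r k ∪ (Finset.range m).biUnion B).card := Finset.card_le_card hsub
    _ ≤ (spreadCompositions r k).card + ((Finset.range m).biUnion B).card :=
        Finset.card_union_le _ _
    _ ≤ (spreadCompositions r k).card + m * (k + r - 1).choose (r - 1) := by
        gcongr
        refine Finset.card_biUnion_le.trans ?_
        refine (Finset.sum_le_sum fun j _ => hB j).trans ?_
        simp

end Odd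

/-! ### The sign of the signed count of double covers -/

theorem sum_range_two_mul {M : Type*} [AddCommMonoid M] (f : ℕ → M) (n : ℕ) :
    ∑ m ∈ Finset.range (2 * n), f m = ∑ q ∈ Finset.range n, (f (2 * q) + f (2 * q + 1)) := by
  induction n with
  | zero => simp
  | succ n ih =>
    rw [show 2 * (n + 1) = 2 * n + 1 + 1 by ring, Finset.sum_range_succ, Finset.sum_range_succ, ih,
      Finset.sum_range_succ, add_assoc]

theorem sum_isDoubleCover_eq {r ℓ M : ℕ} (hM : ℓ < M) (x : ℝ) :
    ∑ F : Finset (Fin ℓ) with IsDoubleCover r F, x ^ F.card =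
      ∑ m ∈ Finset.range M, (doubleCovers r ℓ m).card * x ^ m := by
  rw [← Finset.sum_fiberwise_of_maps_to (g := Finset.card) (t := Finset.range M)]
  · refine Finset.sum_congr rfl fun m _ => ?_
    rw [Finset.filter_filter, ← doubleCovers, Finset.sum_congr rfl fun F hF => by
      rw [(mem_doubleCovers.1 hF).2], Finset.sum_const, nsmul_eq_mul]
  · intro F _
    have := F.card_le_univ
    rw [Fintype.card_fin] at this
    exact Finset.mem_range.2 (by omega)

/-- Among the double covers with an odd number of edges, it is enough to take those with `2k + 1`
edges into account. -/
theorem sum_isDoubleCover_neg {r k : ℕ} (hr : 0 < r) (hk : 0 < k) {c : ℝ} (hc : 0 < c)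
    (h : (doubleCovers r (r * k) (2 * k)).card +
      ∑ t ∈ Finset.Icc 1 (r * k), (doubleCovers r (r * k) (2 * (k + t))).card * c ^ (2 * t) <
      (doubleCovers r (r * k) (2 * k + 1)).card * c) :
    ∑ F : Finset (Fin (r * k)) with IsDoubleCover r F, (-c) ^ F.card < 0 := by
  have hpos : 0 < r * k := Nat.mul_pos hr hk
  have : NeZero (r * k) := ⟨hpos.ne'⟩
  have hle : r ≤ r * k := Nat.le_mul_of_pos_right r hk
  rw [sum_isDoubleCover_eq (M := 2 * (k + (r * k + 1))) (by omega), sum_range_two_mul,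
    Finset.sum_add_distrib]
  have heven : ∑ q ∈ Finset.range (k + (r * k + 1)),
      ((doubleCovers r (r * k) (2 * q)).card : ℝ) * (-c) ^ (2 * q) =
      c ^ (2 * k) * ((doubleCovers r (r * k) (2 * k)).card + ∑ t ∈ Finset.Icc 1 (r * k),
        (doubleCovers r (r * k) (2 * (k + t))).card * c ^ (2 * t)) := by
    rw [Finset.sum_range_add, Finset.sum_eq_zero, zero_add, Finset.sum_range_succ',
      Finset.range_eq_Ico, Finset.sum_Ico_add' (fun t =>
        ((doubleCovers r (r * k) (2 * (k + t))).card : ℝ) * (-c) ^ (2 * (k + t))) 0 (r * k) 1,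
      mul_add (c ^ (2 * k)), add_comm, Finset.mul_sum]
    · congr 1
      · rw [add_zero, (even_two_mul k).neg_pow]
        ring
      · refine Finset.sum_congr (by ext; simp) fun t _ => ?_
        rw [(even_two_mul (k + t)).neg_pow, mul_add 2 k t, pow_add]
        ring
    · intro q hq
      rw [doubleCovers_even_eq_empty hle hr (Finset.mem_range.1 hq)]
      simp
  have hodd : ∑ q ∈ Finset.range (k + (r * k + 1)),
      ((doubleCovers r (r * k) (2 * q + 1)).card : ℝ) * (-c) ^ (2 * q + 1) ≤
      -(c ^ (2 * k) * ((doubleCovers r (r * k) (2 * k + 1)).card * c)) := by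
    have h1 := Finset.single_le_sum (s := Finset.range (k + (r * k + 1)))
      (f := fun q => ((doubleCovers r (r * k) (2 * q + 1)).card : ℝ) * c ^ (2 * q + 1))
      (fun q _ => by positivity) (Finset.mem_range.2 (show k < k + (r * k + 1) by omega))
    have h2 : ∀ q, (-c) ^ (2 * q + 1) = -c ^ (2 * q + 1) := fun q => Odd.neg_pow ⟨q, rfl⟩ c
    simp only [h2, mul_neg, Finset.sum_neg_distrib]
    refine neg_le_neg (le_trans (le_of_eq ?_) h1)
    ring
  have := mul_lt_mul_of_pos_left h (pow_pos hc (2 * k))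
  linarith

/-- The geometric bound for the sum of a sequence whose successive ratios are at most `θ`. -/
theorem sum_Icc_le_of_ratio {x : ℕ → ℝ} {θ : ℝ} (hθ1 : θ < 1)
    (hx : ∀ t, 0 ≤ x t) {a : ℕ} (h : ∀ t, a ≤ t → x (t + 1) ≤ θ * x t) (n : ℕ) :
    ∑ t ∈ Finset.Icc a n, x t ≤ x a / (1 - θ) := by
  have hθ : 0 < 1 - θ := by linarith
  -- The sum up to `n` and the geometric bound for the rest stay below the bound.
  have key : ∀ s, ∑ t ∈ Finset.range s, x (a + t) + x (a + s) / (1 - θ) ≤ x a / (1 - θ) := by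
    intro s
    induction s with
    | zero => simp
    | succ s ih =>
      rw [Finset.sum_range_succ]
      have h1 := h (a + s) (by omega)
      have h2 : x (a + s) + x (a + (s + 1)) / (1 - θ) ≤ x (a + s) / (1 - θ) := by
        rw [le_div_iff₀ hθ, add_mul, div_mul_cancel₀ _ hθ.ne', ← add_assoc a s 1]
        linarith
      linarith
  have h3 : ∑ t ∈ Finset.Icc a n, x t = ∑ t ∈ Finset.range (n + 1 - a), x (a + t) := by
    rw [← Finset.sum_Ico_eq_sum_range]
    rfl
  rw [h3]
  have := key (n + 1 - a)
  have h4 : 0 ≤ x (a + (n + 1 - a)) / (1 - θ) := div_nonneg (hx _) hθ.le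
  linarith

section Bounds

variable {r k : ℕ}

/-- The number of compositions of `r t` into `k + t` parts, where parts may be zero. -/
def evenChoose (r k t : ℕ) : ℕ := (k + t + r * t - 1).choose (r * t)

/-- The bound for based covers, transferred to all covers by rotation invariance. -/
theorem card_doubleCovers_even_le (hr : 0 < r) (hk : 0 < k) (t : ℕ) :
    ((doubleCovers r (r * k) (2 * (k + t))).card : ℝ) ≤
      (r * (r - 1) / 2) * ((k / (k + t)) * (evenChoose r k t : ℝ) ^ 2) := by
  have : NeZero (r * k) := ⟨(Nat.mul_pos hr hk).ne'⟩
  have hle : r ≤ r * k := Nat.le_mul_of_pos_right r hk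
  have h1 := mul_card_doubleCovers hle (2 * (k + t))
  have h2 := card_basedDoubleCovers_even_le hle (q := k + t) (by omega)
  rw [Nat.add_sub_cancel_left] at h2
  have h3 : 2 * (k + t) * (doubleCovers r (r * k) (2 * (k + t))).card ≤
      r * k * ((r - 1) * evenChoose r k t ^ 2) := by
    rw [h1]
    exact Nat.mul_le_mul_left _ h2
  have h4 : (2 * (k + t) * (doubleCovers r (r * k) (2 * (k + t))).card : ℝ) ≤
      r * k * ((r - 1) * (evenChoose r k t : ℝ) ^ 2) := by
    have h5 : ((r - 1 : ℕ) : ℝ) = r - 1 := by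
      rw [Nat.cast_sub hr, Nat.cast_one]
    rw [← h5]
    exact_mod_cast h3
  have hk' : (0 : ℝ) < k + t := by
    have : (0 : ℝ) < k := by exact_mod_cast hk
    positivity
  have h6 : (r * (r - 1) / 2) * ((k / (k + t)) * (evenChoose r k t : ℝ) ^ 2) =
      r * k * ((r - 1) * (evenChoose r k t : ℝ) ^ 2) / (2 * (k + t)) := by
    field_simp
  rw [h6, le_div_iff₀ (by positivity)]
  linarith

/-- The lower bound for the number of double covers with `2k + 1` edges. -/
noncomputable def oddBound (r k : ℕ) : ℝ :=
  r * k / (2 * k + 1) * (2 * k + r).choose r - r * k * (k + r - 1).choose (r - 1)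

theorem oddBound_le (hr : 0 < r) (hk : 0 < k) :
    oddBound r k ≤ (doubleCovers r (r * k) (2 * k + 1)).card := by
  have : NeZero (r * k) := ⟨(Nat.mul_pos hr hk).ne'⟩
  have hle : r ≤ r * k := Nat.le_mul_of_pos_right r hk
  have h1 := mul_card_doubleCovers hle (2 * k + 1)
  have h2 := (choose_le_card_spreadCompositions (k := k) hr).trans
    (Nat.add_le_add_right (card_spreadCompositions_le hle) _)
  have h1' : ((2 * k + 1) * (doubleCovers r (r * k) (2 * k + 1)).card : ℝ) =
      r * k * (basedDoubleCovers r (r * k) (2 * k + 1)).card := by exact_mod_cast h1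
  have h2' : ((2 * k + r).choose r : ℝ) ≤ (basedDoubleCovers r (r * k) (2 * k + 1)).card +
      (2 * k + 1) * (k + r - 1).choose (r - 1) := by exact_mod_cast h2
  have h3 : (0 : ℝ) < 2 * k + 1 := by positivity
  have h4 : (0 : ℝ) ≤ r * k := by positivity
  have h5 : oddBound r k = (r * k * ((2 * k + r).choose r -
      (2 * k + 1) * (k + r - 1).choose (r - 1))) / (2 * k + 1) := by
    rw [oddBound]
    field_simp
  rw [h5, div_le_iff₀ h3, mul_comm _ (2 * (k : ℝ) + 1), h1']
  exact mul_le_mul_of_nonneg_left (by linarith) h4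

/-- With `c = r (r - 1) / p`, where `p` is a lower bound for the number of double covers with
`2k + 1` edges, these covers have at least twice the weight of those with `2k` edges. It remains to
bound the contribution of the larger even covers. -/
theorem not_isSidorenko_of_even_lt (hr : 1 < r) (hk : 1 < k) {p : ℝ}
    (hp : r * (r - 1) ≤ p) (hp2 : p ≤ (doubleCovers r (r * k) (2 * k + 1)).card)
    (h : ∑ t ∈ Finset.Icc 1 (r * k), (doubleCovers r (r * k) (2 * (k + t))).card *
      (r * (r - 1) / p) ^ (2 * t) < r * (r - 1) / 2) (hℓ : r < r * k) :
    ¬ (tightCycle r (r * k) hℓ.le).IsSidorenko := by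
  have hr' : (1 : ℝ) < r := by exact_mod_cast hr
  have hrr : (0 : ℝ) < r * (r - 1) := mul_pos (by linarith) (by linarith)
  have hp0 : 0 < p := by linarith
  have hc : 0 < r * (r - 1) / p := div_pos hrr hp0
  refine not_isSidorenko_of_sum_neg (by omega) hℓ hc.le ((div_le_one hp0).2 hp)
    (sum_isDoubleCover_neg (by omega) (by omega) hc ?_)
  have h0 := card_doubleCovers_even_le (r := r) (k := k) (by omega) (by omega) 0
  have hk' : (k : ℝ) ≠ 0 := by
    have : (1 : ℝ) < k := by exact_mod_cast hk
    linarith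
  simp only [evenChoose, add_zero, mul_zero, Nat.choose_zero_right, Nat.cast_one, Nat.cast_zero,
    one_pow, mul_one, div_self hk'] at h0
  have h1 : r * (r - 1) ≤ (doubleCovers r (r * k) (2 * k + 1)).card * (r * (r - 1) / p) := by
    rw [← mul_div_assoc, le_div_iff₀ hp0, mul_comm]
    exact mul_le_mul_of_nonneg_right hp2 hrr.le
  linarith

end Bounds

/-! ### Binomial coefficients as polynomials -/

theorem choose_two_real (n : ℕ) : ((n + 2).choose 2 : ℝ) = (n + 1) * (n + 2) / 2 := by
  have h := Nat.ascFactorial_eq_factorial_mul_choose n 2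
  have h' : ((n + 1).ascFactorial 2 : ℝ) = Nat.factorial 2 * (n + 2).choose 2 := by
    exact_mod_cast h
  simp only [Nat.ascFactorial, Nat.factorial] at h'
  push_cast at h'
  linarith

theorem choose_three_real (n : ℕ) :
    ((n + 3).choose 3 : ℝ) = (n + 1) * (n + 2) * (n + 3) / 6 := by
  have h := Nat.ascFactorial_eq_factorial_mul_choose n 3
  have h' : ((n + 1).ascFactorial 3 : ℝ) = Nat.factorial 3 * (n + 3).choose 3 := by
    exact_mod_cast h
  simp only [Nat.ascFactorial, Nat.factorial] at h'
  push_cast at h'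
  linarith

theorem choose_four_real (n : ℕ) :
    ((n + 4).choose 4 : ℝ) = (n + 1) * (n + 2) * (n + 3) * (n + 4) / 24 := by
  have h := Nat.ascFactorial_eq_factorial_mul_choose n 4
  have h' : ((n + 1).ascFactorial 4 : ℝ) = Nat.factorial 4 * (n + 4).choose 4 := by
    exact_mod_cast h
  simp only [Nat.ascFactorial, Nat.factorial] at h'
  push_cast at h'
  linarith

theorem choose_five_real (n : ℕ) :
    ((n + 5).choose 5 : ℝ) = (n + 1) * (n + 2) * (n + 3) * (n + 4) * (n + 5) / 120 := by
  have h := Nat.ascFactorial_eq_factorial_mul_choose n 5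
  have h' : ((n + 1).ascFactorial 5 : ℝ) = Nat.factorial 5 * (n + 5).choose 5 := by
    exact_mod_cast h
  simp only [Nat.ascFactorial, Nat.factorial] at h'
  push_cast at h'
  linarith

/-! ### The general case -/

section General

theorem choose_succ_mul (n a b : ℕ) :
    (((a + (n + 1) + b).choose b : ℕ) : ℝ) * (a + n + 1) =
      ((a + n + b).choose b) * (a + n + 1 + b) := by
  have h := Nat.choose_mul_succ_eq (a + n + b) b
  rw [show a + n + b + 1 - b = a + n + 1 by omega] at h
  rw [show a + (n + 1) + b = a + n + b + 1 by ring]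
  have h2 : ((a + n + b).choose b : ℝ) * (a + n + b + 1) =
    (a + n + b + 1).choose b * (a + n + 1) := by exact_mod_cast h
  linarith

theorem evenChoose_pos {r k t : ℕ} (hk : 0 < k) : 0 < evenChoose r k t :=
  Nat.choose_pos (by omega)

theorem evenChoose_succ_mul (r n t : ℕ) :
    (evenChoose r (n + 2) t : ℝ) * (n + 1 + t) =
      evenChoose r (n + 1) t * ((r + 1) * t + n + 1) := by
  have h := choose_succ_mul n t (r * t)
  rw [evenChoose, evenChoose, show n + 2 + t + r * t - 1 = t + (n + 1) + r * t by omega,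
    show n + 1 + t + r * t - 1 = t + n + r * t by omega]
  push_cast at h
  linarith

/-- One step of the induction on `k` in the comparison of `C_{t+1}` with `C_t C_1`, where `C_t`
counts compositions of `r t` into `k + t` parts. -/
theorem evenChoose_ratio_step {r n t : ℕ} {x y : ℝ}
    (hxy : x * (((r + 1) * (t + 1) + n + 1) * (t + n + 1) * (n + 2)) ≤
      y * ((t + n + 2) * ((r + 1) * t + n + 1) * (r + n + 2)))
    (h : (evenChoose r (n + 1) (t + 1) : ℝ) ≤
      x * (evenChoose r (n + 1) t * evenChoose r (n + 1) 1)) :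
    (evenChoose r (n + 2) (t + 1) : ℝ) ≤
      y * (evenChoose r (n + 2) t * evenChoose r (n + 2) 1) := by
  have h1 := evenChoose_succ_mul r n (t + 1)
  have h2 := evenChoose_succ_mul r n t
  have h3 := evenChoose_succ_mul r n 1
  push_cast at h1 h2 h3
  have p1 : (0 : ℝ) < n + 1 + (t + 1) := by positivity
  have p2 : (0 : ℝ) < n + 1 + t := by positivity
  have p3 : (0 : ℝ) < n + 1 + 1 := by positivity
  have e1 := eq_div_of_mul_eq p1.ne' h1
  have e2 := eq_div_of_mul_eq p2.ne' h2
  have e3 := eq_div_of_mul_eq p3.ne' h3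
  rw [e1, e2, e3]
  set a : ℝ := (evenChoose r (n + 1) t : ℝ)
  set b : ℝ := (evenChoose r (n + 1) 1 : ℝ)
  have ha0 : 0 ≤ a * b := by positivity
  have q1 : (0 : ℝ) ≤ (r + 1) * (t + 1) + n + 1 := by positivity
  calc (evenChoose r (n + 1) (t + 1) : ℝ) * ((r + 1) * (t + 1) + n + 1) / (n + 1 + (t + 1))
      ≤ x * (a * b) * ((r + 1) * (t + 1) + n + 1) / (n + 1 + (t + 1)) := by gcongr
    _ = (a * b) * (x * (((r + 1) * (t + 1) + n + 1) * (t + n + 1) * (n + 2))) /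
        ((n + 1 + (t + 1)) * (n + 1 + t) * (n + 2)) := by
        field_simp
        ring
    _ ≤ (a * b) * (y * ((t + n + 2) * ((r + 1) * t + n + 1) * (r + n + 2))) /
        ((n + 1 + (t + 1)) * (n + 1 + t) * (n + 2)) := by gcongr
    _ = _ := by
        field_simp
        ring

theorem one_add_inv_pow_le_three {r : ℕ} (hr : 0 < r) : (((r : ℝ) + 1) / r) ^ r ≤ 3 := by
  have hr' : (0 : ℝ) < r := by exact_mod_cast hr
  calc (((r : ℝ) + 1) / r) ^ r ≤ Real.exp (1 / r) ^ r := by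
        gcongr
        rw [add_div, div_self hr'.ne', add_comm]
        exact Real.add_one_le_exp _
    _ = Real.exp 1 := by
        rw [← Real.exp_nat_mul, mul_one_div_cancel hr'.ne']
    _ ≤ 3 := by linarith [Real.exp_one_lt_d9]

/-- For `k = 1` the ratio `C_{t+1} / (C_t C_1)` is at most `(1 + 1 / r) ^ r`. -/
theorem evenChoose_ratio_one {r : ℕ} (hr : 0 < r) (t : ℕ) :
    (evenChoose r 1 (t + 1) : ℝ) ≤ 3 * (evenChoose r 1 t * evenChoose r 1 1) := by
  have hr' : (0 : ℝ) < r := by exact_mod_cast hr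
  -- Add the `r` new units to the lower index one at a time.
  have key : ∀ s, ((t + (r * t + s)).choose (r * t + s) : ℝ) ≤
      ((r + 1) / r) ^ s * (t + r * t).choose (r * t) := by
    intro s
    induction s with
    | zero => simp
    | succ s ih =>
      have h := Nat.add_one_mul_choose_eq (t + (r * t + s)) (r * t + s)
      have h' : ((t + (r * t + s) + 1 : ℝ)) * (t + (r * t + s)).choose (r * t + s) =
          (t + (r * t + s) + 1).choose (r * t + s + 1) * (r * t + s + 1) := by
        exact_mod_cast h
      have hp : (0 : ℝ) < r * t + s + 1 := by positivity
      rw [show t + (r * t + (s + 1)) = t + (r * t + s) + 1 by ring, ← add_assoc (r * t) s 1,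
        eq_div_of_mul_eq hp.ne' h'.symm, pow_succ]
      have h2 : (t + (r * t + s) + 1 : ℝ) / (r * t + s + 1) ≤ (r + 1) / r := by
        rw [div_le_div_iff₀ hp hr']
        have : (0 : ℝ) ≤ s := by positivity
        nlinarith
      calc (t + (r * t + s) + 1 : ℝ) * (t + (r * t + s)).choose (r * t + s) / (r * t + s + 1)
          = (t + (r * t + s) + 1 : ℝ) / (r * t + s + 1) *
            (t + (r * t + s)).choose (r * t + s) := by ring
        _ ≤ (r + 1) / r * (((r + 1) / r) ^ s * (t + r * t).choose (r * t)) := by gcongr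
        _ = _ := by ring
  have h1 := key r
  have h2 := choose_succ_mul t 0 (r * t + r)
  have h3 : evenChoose r 1 (t + 1) = (0 + (t + 1) + (r * t + r)).choose (r * t + r) := by
    rw [evenChoose, show r * (t + 1) = r * t + r by ring]
    congr 1
    omega
  have h4 : evenChoose r 1 t = (t + r * t).choose (r * t) := by
    rw [evenChoose]
    congr 1
    omega
  have h5 : (evenChoose r 1 1 : ℝ) = r + 1 := by
    rw [evenChoose, show 1 + 1 + r * 1 - 1 = r + 1 by omega, mul_one, Nat.choose_succ_self_right]
    push_cast
    ring
  rw [← h3, zero_add t] at h2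
  rw [h4, h5]
  have ht : (0 : ℝ) < t + 1 := by positivity
  have h6 : (evenChoose r 1 (t + 1) : ℝ) =
      (r + 1) * ((t + (r * t + r)).choose (r * t + r) : ℕ) := by
    have h7 : (evenChoose r 1 (t + 1) : ℝ) * (t + 1) =
        ((r + 1) * ((t + (r * t + r)).choose (r * t + r) : ℕ)) * (t + 1) := by
      push_cast at h2
      rw [zero_add] at h2
      rw [h2]
      ring
    exact mul_right_cancel₀ ht.ne' h7
  rw [h6]
  have h8 : ((t + (r * t + r)).choose (r * t + r) : ℝ) ≤ 3 * (t + r * t).choose (r * t) :=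
    h1.trans (by gcongr; exact one_add_inv_pow_le_three hr)
  nlinarith

/-- The ratio `C_{t+1} / (C_t C_1)` does not increase with `k`. -/
theorem evenChoose_ratio_mono {r t k₀ : ℕ} (hr : 1 ≤ r) (ht : 1 ≤ t) (hk₀ : 0 < k₀) {x : ℝ}
    (hx : 0 ≤ x) (h : (evenChoose r k₀ (t + 1) : ℝ) ≤
      x * (evenChoose r k₀ t * evenChoose r k₀ 1)) {k : ℕ} (hk : k₀ ≤ k) :
    (evenChoose r k (t + 1) : ℝ) ≤ x * (evenChoose r k t * evenChoose r k 1) := by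
  induction k, hk using Nat.le_induction with
  | base => exact h
  | succ k hk ih =>
    obtain ⟨n, rfl⟩ : ∃ n, k = n + 1 := ⟨k - 1, by omega⟩
    refine evenChoose_ratio_step (mul_le_mul_of_nonneg_left ?_ hx) ih
    obtain ⟨u, rfl⟩ := Nat.exists_eq_add_of_le hr
    obtain ⟨s, rfl⟩ := Nat.exists_eq_add_of_le ht
    rw [← sub_nonneg]
    push_cast
    ring_nf
    positivity

/-- The ratio `C_{t+1} / (C_t C_1)` is at most `1 / 2`. For `k = 1` it is at most three; the first
steps in `k` reduce it by explicit factors, and it does not increase after that. -/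
theorem evenChoose_ratio_le_half {r k t : ℕ} (ht : 1 ≤ t)
    (h : 4 ≤ k ∧ 5 ≤ r ∨ 3 ≤ k ∧ 11 ≤ r) :
    2 * (evenChoose r k (t + 1) : ℝ) ≤ evenChoose r k t * evenChoose r k 1 := by
  have ht' : (1 : ℝ) ≤ t := by exact_mod_cast ht
  have h1 := evenChoose_ratio_one (r := r) (by omega) t
  have step : ∀ (n : ℕ) {x y : ℝ}, 0 ≤ x →
      2 * (n + 2) ^ 2 * x ≤ (n + 3) * (n + 2 + r) * y →
      (evenChoose r (n + 1) (t + 1) : ℝ) ≤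
        x * (evenChoose r (n + 1) t * evenChoose r (n + 1) 1) →
      (evenChoose r (n + 2) (t + 1) : ℝ) ≤
        y * (evenChoose r (n + 2) t * evenChoose r (n + 2) 1) := by
    intro n x y hx hxy
    refine evenChoose_ratio_step ?_
    have h2 : (((r + 1) * (t + 1) + n + 1) * (t + n + 1) * (n + 3) : ℝ) ≤
        2 * (n + 2) * ((t + n + 2) * ((r + 1) * t + n + 1)) := by
      obtain ⟨s, rfl⟩ := Nat.exists_eq_add_of_le ht
      rw [← sub_nonneg]
      push_cast
      ring_nf
      positivity
    have h3 : (0 : ℝ) < n + 3 := by positivity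
    refine le_of_mul_le_mul_right ?_ h3
    calc x * (((r + 1) * (t + 1) + n + 1) * (t + n + 1) * (n + 2)) * (n + 3)
        = x * (n + 2) * (((r + 1) * (t + 1) + n + 1) * (t + n + 1) * (n + 3)) := by ring
      _ ≤ x * (n + 2) * (2 * (n + 2) * ((t + n + 2) * ((r + 1) * t + n + 1))) := by gcongr
      _ = (2 * (n + 2) ^ 2 * x) * ((t + n + 2) * ((r + 1) * t + n + 1)) := by ring
      _ ≤ ((n + 3) * (n + 2 + r) * y) * ((t + n + 2) * ((r + 1) * t + n + 1)) := by gcongr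
      _ = _ := by ring
  have hhalf : ∃ k₀, 0 < k₀ ∧ k₀ ≤ k ∧ (evenChoose r k₀ (t + 1) : ℝ) ≤
      1 / 2 * (evenChoose r k₀ t * evenChoose r k₀ 1) := by
    rcases h with ⟨hk, hr⟩ | ⟨hk, hr⟩
    · have hr' : (5 : ℝ) ≤ r := by exact_mod_cast hr
      have h2 := step 0 (x := 3) (y := 8 / 7) (by norm_num)
        (by push_cast; nlinarith) h1
      have h3 := step 1 (x := 8 / 7) (y := 9 / 14) (by norm_num)
        (by push_cast; nlinarith) h2
      exact ⟨4, by norm_num, hk, step 2 (x := 9 / 14) (y := 1 / 2) (by norm_num)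
        (by push_cast; nlinarith) h3⟩
    · have hr' : (11 : ℝ) ≤ r := by exact_mod_cast hr
      have h2 := step 0 (x := 3) (y := 8 / 13) (by norm_num)
        (by push_cast; nlinarith) h1
      exact ⟨3, by norm_num, hk, step 1 (x := 8 / 13) (y := 1 / 2) (by norm_num)
        (by push_cast; nlinarith) h2⟩
  obtain ⟨k₀, hk₀, hkk, hb⟩ := hhalf
  have := evenChoose_ratio_mono (by omega) ht hk₀ (by norm_num) hb hkk
  linarith

/-- If `c * evenChoose r k 1 ≤ σ < 2`, the contributions of the larger even double covers decay
geometrically, with ratio at most `σ ^ 2 / 4`. -/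
theorem sum_even_le {r k : ℕ} (hr : 1 < r) (hk : 0 < k)
    (h : 4 ≤ k ∧ 5 ≤ r ∨ 3 ≤ k ∧ 11 ≤ r) {c σ : ℝ} (hc : 0 ≤ c)
    (hσ : c * evenChoose r k 1 ≤ σ) (hσ1 : σ < 2) {a : ℕ} (ha : 1 ≤ a) (n : ℕ) :
    ∑ t ∈ Finset.Icc a n, (doubleCovers r (r * k) (2 * (k + t))).card * c ^ (2 * t) ≤
      (r * (r - 1) / 2) * ((k / (k + a)) * (evenChoose r k a * c ^ a) ^ 2 / (1 - σ ^ 2 / 4)) := by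
  have hr' : (1 : ℝ) < r := by exact_mod_cast hr
  have hk' : (0 : ℝ) < k := by exact_mod_cast hk
  have hrr : (0 : ℝ) ≤ r * (r - 1) / 2 := by
    have : (0 : ℝ) < r * (r - 1) := mul_pos (by linarith) (by linarith)
    linarith
  have hσ0 : 0 ≤ σ := le_trans (by positivity) hσ
  have h1 : ∀ t, ((doubleCovers r (r * k) (2 * (k + t))).card : ℝ) * c ^ (2 * t) ≤
      (r * (r - 1) / 2) * ((k / (k + t)) * (evenChoose r k t * c ^ t) ^ 2) := by
    intro t
    calc _ ≤ ((r * (r - 1) / 2) * ((k / (k + t)) * (evenChoose r k t : ℝ) ^ 2)) * c ^ (2 * t) := by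
          gcongr
          exact card_doubleCovers_even_le (by omega) hk t
      _ = _ := by ring
  refine (Finset.sum_le_sum fun t _ => h1 t).trans ?_
  rw [← Finset.mul_sum]
  refine mul_le_mul_of_nonneg_left ?_ hrr
  refine sum_Icc_le_of_ratio (x := fun t : ℕ => (k / (k + t)) * (evenChoose r k t * c ^ t) ^ 2)
    (by nlinarith) (fun t => by positivity) (fun t hat => ?_) n
  have h2 := evenChoose_ratio_le_half (r := r) (k := k) (t := t) (by omega) h
  have h3 : (evenChoose r k (t + 1) : ℝ) * c ^ (t + 1) ≤ σ / 2 * (evenChoose r k t * c ^ t) := by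
    calc (evenChoose r k (t + 1) : ℝ) * c ^ (t + 1)
        ≤ (evenChoose r k t * evenChoose r k 1 / 2) * c ^ (t + 1) := by
          gcongr
          linarith
      _ = (c * evenChoose r k 1) / 2 * (evenChoose r k t * c ^ t) := by ring
      _ ≤ σ / 2 * (evenChoose r k t * c ^ t) := by gcongr
  calc (k : ℝ) / (k + (t + 1 : ℕ)) * (evenChoose r k (t + 1) * c ^ (t + 1)) ^ 2
      ≤ k / (k + t) * (σ / 2 * (evenChoose r k t * c ^ t)) ^ 2 := by
        gcongr
        omega
    _ = σ ^ 2 / 4 * (k / (k + t) * (evenChoose r k t * c ^ t) ^ 2) := by ring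

end General

section General

/-- The inequality that makes `r (r - 1) C_1` at most `22 / 25` of the lower bound for the number
of double covers with `2k + 1` edges. -/
def OddBoundLarge (r k : ℕ) : Prop :=
  ((k + r).choose r : ℝ) * ((r - 1) * (r + k) + 22 / 25 * k * r) * (2 * k + 1) ≤
    22 / 25 * k * (r + k) * (2 * k + r).choose r

theorem OddBoundLarge.succ {r k : ℕ} (hkr : 2 * k + r + 1 ≤ k * r) (h : OddBoundLarge r k) :
    OddBoundLarge (r + 1) k := by
  have hstep : ∀ n : ℕ, ((n + (r + 1)).choose (r + 1) : ℝ) =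
      (n + r).choose r * (n + r + 1) / (r + 1) := by
    intro n
    have h1 := Nat.add_one_mul_choose_eq (n + r) r
    have h2 : ((n + r + 1 : ℝ)) * (n + r).choose r = (n + r + 1).choose (r + 1) * (r + 1) := by
      exact_mod_cast h1
    rw [← add_assoc n r 1, eq_div_iff (by positivity), ← h2]
    ring
  have hkr' : (2 * k + r + 1 : ℝ) ≤ k * r := by exact_mod_cast hkr
  unfold OddBoundLarge at h ⊢
  rw [hstep k]
  have h3 := hstep (2 * k)
  push_cast at h3 ⊢
  rw [h3]
  set A : ℝ := ((k + r).choose r : ℝ)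
  set D : ℝ := ((2 * k + r).choose r : ℝ)
  have hA : 0 ≤ A := by positivity
  have hr1 : (0 : ℝ) < r + 1 := by positivity
  have hk0 : (0 : ℝ) ≤ k := by positivity
  have hr0 : (0 : ℝ) ≤ r := by positivity
  rcases eq_or_lt_of_le (show (0 : ℝ) ≤ r + k by positivity) with h0 | h0
  · nlinarith
  have h4 : (r * (r + 1 + k) + 22 / 25 * k * (r + 1) : ℝ) * (r + k) ≤
      ((r - 1) * (r + k) + 22 / 25 * k * r) * (2 * k + r + 1) := by
    nlinarith [mul_nonneg (sub_nonneg.2 hkr') h0.le, mul_nonneg hk0 (sub_nonneg.2 hkr'),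
      mul_nonneg hk0 hr0, mul_nonneg hk0 hk0]
  refine le_of_mul_le_mul_right ?_ h0
  calc A * (k + r + 1) / (r + 1) * ((r + 1 - 1) * (r + 1 + k) + 22 / 25 * k * (r + 1)) *
        (2 * k + 1) * (r + k)
      = A * (2 * k + 1) * (k + r + 1) / (r + 1) *
        ((r * (r + 1 + k) + 22 / 25 * k * (r + 1)) * (r + k)) := by ring
    _ ≤ A * (2 * k + 1) * (k + r + 1) / (r + 1) *
        (((r - 1) * (r + k) + 22 / 25 * k * r) * (2 * k + r + 1)) := by gcongr
    _ = (A * ((r - 1) * (r + k) + 22 / 25 * k * r) * (2 * k + 1)) *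
        ((k + r + 1) * (2 * k + r + 1) / (r + 1)) := by ring
    _ ≤ (22 / 25 * k * (r + k) * D) * ((k + r + 1) * (2 * k + r + 1) / (r + 1)) := by gcongr
    _ = _ := by ring

theorem oddBoundLarge_of_le {r₀ r k : ℕ} (hk : 3 ≤ k) (hr₀ : 5 ≤ r₀) (h : OddBoundLarge r₀ k)
    (hr : r₀ ≤ r) : OddBoundLarge r k := by
  induction r, hr using Nat.le_induction with
  | base => exact h
  | succ r hr ih =>
    refine ih.succ ?_
    obtain ⟨s, rfl⟩ := Nat.exists_eq_add_of_le hk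
    obtain ⟨u, rfl⟩ := Nat.exists_eq_add_of_le (hr₀.trans hr)
    ring_nf
    nlinarith [Nat.zero_le (s * u)]

theorem oddBoundLarge_five {k : ℕ} (hk : 9 ≤ k) : OddBoundLarge 5 k := by
  unfold OddBoundLarge
  have h2 := choose_five_real (2 * k)
  push_cast at h2
  rw [choose_five_real, h2]
  obtain ⟨s, rfl⟩ := Nat.exists_eq_add_of_le hk
  rw [← sub_nonneg]
  push_cast
  ring_nf
  positivity

/-- The inequality passes from `r` to `r + 1`, so that for each `k` a single value of `r` has to be
checked. -/
theorem oddBoundLarge_of_lt {r k : ℕ} (h : 9 ≤ k ∧ 5 ≤ r ∨ 5 ≤ k ∧ 7 ≤ r ∨ k = 4 ∧ 9 ≤ r ∨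
    k = 3 ∧ 11 ≤ r) : OddBoundLarge r k := by
  have base : ∀ {r₀ k : ℕ} (A D : ℕ), (k + r₀).choose r₀ = A → (2 * k + r₀).choose r₀ = D →
      (A * ((r₀ - 1) * (r₀ + k) + 22 / 25 * k * r₀) * (2 * k + 1) : ℝ) ≤
        22 / 25 * k * (r₀ + k) * D → OddBoundLarge r₀ k := by
    rintro r₀ k _ _ rfl rfl h
    exact h
  by_cases hk9 : 9 ≤ k
  · exact oddBoundLarge_of_le (by omega) le_rfl (oddBoundLarge_five hk9) (by omega)
  by_cases hk5 : 5 ≤ k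
  · refine oddBoundLarge_of_le (r₀ := 7) (by omega) (by norm_num) ?_ (by omega)
    interval_cases k
    · exact base 792 19448 (by decide +kernel) (by decide +kernel) (by norm_num)
    · exact base 1716 50388 (by decide +kernel) (by decide +kernel) (by norm_num)
    · exact base 3432 116280 (by decide +kernel) (by decide +kernel) (by norm_num)
    · exact base 6435 245157 (by decide +kernel) (by decide +kernel) (by norm_num)
  obtain ⟨rfl, hr⟩ | ⟨rfl, hr⟩ : k = 4 ∧ 9 ≤ r ∨ k = 3 ∧ 11 ≤ r := by omega
  · exact oddBoundLarge_of_le (by norm_num) (by norm_num)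
      (base 715 24310 (by decide +kernel) (by decide +kernel) (by norm_num)) hr
  · exact oddBoundLarge_of_le (by norm_num) (by norm_num)
      (base 364 12376 (by decide +kernel) (by decide +kernel) (by norm_num)) hr

/-- The inequality `OddBoundLarge` in the form in which it enters the geometric estimate: `c C_1`
is at most `22 / 25`, where `c` is the coefficient of the kernel. -/
theorem mul_evenChoose_one_le_oddBound {r k : ℕ} (hr : 0 < r) (h : OddBoundLarge r k) :
    r * (r - 1) * evenChoose r k 1 ≤ 22 / 25 * oddBound r k := by
  have hkr : (0 : ℝ) < r + k := by
    have : (0 : ℝ) < r := by exact_mod_cast hr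
    positivity
  have h1 : ((k + r - 1).choose (r - 1) : ℝ) * (r + k) = (k + r).choose r * r := by
    obtain ⟨s, rfl⟩ := Nat.exists_eq_add_of_le' hr
    have h2 := Nat.add_one_mul_choose_eq (k + s) s
    have h3 : ((k + s + 1 : ℝ)) * (k + s).choose s = (k + s + 1).choose (s + 1) * (s + 1) := by
      exact_mod_cast h2
    simp only [← add_assoc, Nat.add_sub_cancel]
    push_cast
    linarith
  have h4 : evenChoose r k 1 = (k + r).choose r := by
    rw [evenChoose, mul_one, show k + 1 + r - 1 = k + r by omega]
  have h5 := eq_div_of_mul_eq hkr.ne' h1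
  rw [h4, oddBound, h5]
  unfold OddBoundLarge at h
  have h6 : (0 : ℝ) < 2 * k + 1 := by positivity
  rw [← sub_nonneg]
  have h7 : 22 / 25 * (r * k / (2 * k + 1) * (2 * k + r).choose r -
      r * k * ((k + r).choose r * r / (r + k))) - r * (r - 1) * (k + r).choose r =
      r * (22 / 25 * k * (r + k) * (2 * k + r).choose r - (k + r).choose r *
        ((r - 1) * (r + k) + 22 / 25 * k * r) * (2 * k + 1)) / ((2 * k + 1) * (r + k) : ℝ) := by
    field_simp
    ring
  rw [h7]
  exact div_nonneg (mul_nonneg (by positivity) (by linarith)) (by positivity)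

theorem not_isSidorenko_of_oddBoundLarge {r k : ℕ} (hk : 4 ≤ k ∧ 5 ≤ r ∨ 3 ≤ k ∧ 11 ≤ r)
    (h : OddBoundLarge r k) (hℓ : r < r * k) : ¬ (tightCycle r (r * k) hℓ.le).IsSidorenko := by
  have hr : 1 < r := by omega
  have hr' : (1 : ℝ) < r := by exact_mod_cast hr
  have hrr : (0 : ℝ) < r * (r - 1) := mul_pos (by linarith) (by linarith)
  have h1 := mul_evenChoose_one_le_oddBound (by omega) h
  have h2 : (1 : ℝ) ≤ evenChoose r k 1 := by
    exact_mod_cast Nat.succ_le_of_lt (evenChoose_pos (by omega))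
  have h3 : (r * (r - 1) : ℝ) ≤ r * (r - 1) * evenChoose r k 1 :=
    le_mul_of_one_le_right hrr.le h2
  have hp : 0 < oddBound r k := by linarith
  refine not_isSidorenko_of_even_lt hr (by omega) (by linarith)
    (oddBound_le (by omega) (by omega)) ?_ hℓ
  have hc : 0 ≤ r * (r - 1) / oddBound r k := (div_pos hrr hp).le
  have hσ : r * (r - 1) / oddBound r k * evenChoose r k 1 ≤ 22 / 25 := by
    rw [div_mul_eq_mul_div, div_le_iff₀ hp]
    exact h1
  refine (sum_even_le hr (by omega) hk hc hσ (by norm_num) le_rfl _).trans_lt ?_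
  refine mul_lt_of_lt_one_right (by linarith) ?_
  rw [div_lt_one (by norm_num), pow_one, mul_comm (evenChoose r k 1 : ℝ)]
  calc (k : ℝ) / (k + (1 : ℕ)) * (r * (r - 1) / oddBound r k * evenChoose r k 1) ^ 2
      ≤ 1 * (22 / 25) ^ 2 := by
        gcongr
        exact div_le_one_of_le₀ (by linarith [Nat.cast_nonneg (α := ℝ) 1]) (by positivity)
    _ < _ := by norm_num

end General

/-! ### Uniformity three -/

section Three

variable {k : ℕ}

theorem mul_card_doubleCovers_filter_notMem {r ℓ : ℕ} [NeZero ℓ] (hℓ : r ≤ ℓ) (m : ℕ) :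
    (ℓ - m) * (doubleCovers r ℓ m).card =
      ℓ * ((doubleCovers r ℓ m).filter fun F => 0 ∉ F).card := by
  have h1 := mul_card_doubleCovers hℓ m
  have h2 := Finset.card_filter_add_card_filter_not (s := doubleCovers r ℓ m) (fun F => 0 ∈ F)
  rw [Nat.sub_mul, h1, ← h2, Nat.mul_add, basedDoubleCovers, Nat.add_sub_cancel_left]

/-- In a double cover of a tight cycle of uniformity three, the vertices that are not starting
points of an edge have pairwise cyclic distance at least three. -/
theorem cyclicEnum_compl_add_three_le {ℓ : ℕ} [NeZero ℓ] (hℓ : 3 ≤ ℓ) {F : Finset (Fin ℓ)}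
    (hF : IsDoubleCover 3 F) (hne : Fᶜ.Nonempty) (n : ℕ) :
    cyclicEnum Fᶜ n + 3 ≤ cyclicEnum Fᶜ (n + 1) := by
  set x := cyclicEnum Fᶜ n with hx
  set y := cyclicEnum Fᶜ (n + 1) with hy
  have hxy : x < y := cyclicEnum_strictMono hne (Nat.lt_succ_self n)
  have hxF : Fin.ofNat ℓ x ∉ F := Finset.mem_compl.1 (ofNat_cyclicEnum_mem hne n)
  have hyF : Fin.ofNat ℓ y ∉ F := Finset.mem_compl.1 (ofNat_cyclicEnum_mem hne (n + 1))
  by_contra hlt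
  -- The vertex `x + ℓ + 2` lies in the edges starting at `x`, `x + 1` and `x + 2` only.
  have h := count_add_cycleDegree hℓ F (x + ℓ - 1)
  have h2 := hF (Fin.ofNat ℓ (x + ℓ - 1 + 3))
  have h3 : x + ℓ - 1 + 1 = x + ℓ := by omega
  rw [h3, show x + ℓ + 3 = x + ℓ + 1 + 1 + 1 by ring, Nat.count_succ, Nat.count_succ,
    Nat.count_succ, show x + ℓ + 1 + 1 = x + 2 + ℓ by ring, show x + ℓ + 1 = x + 1 + ℓ by ring] at h
  simp only [ofNat_add_self] at h
  rw [if_neg hxF] at h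
  obtain h4 | h4 : y = x + 1 ∨ y = x + 2 := by omega
  · rw [h4] at hyF
    rw [if_neg hyF] at h
    split_ifs at h <;> omega
  · rw [h4] at hyF
    rw [if_neg hyF] at h
    split_ifs at h <;> omega

/-- The gaps between consecutive non-members of a double cover, each reduced by three, form a
composition. -/
theorem card_doubleCovers_three_filter_le {j m : ℕ} (hj : 0 < j) (hm : m + j = 3 * k) :
    have : NeZero (3 * k) := ⟨by omega⟩
    ((doubleCovers 3 (3 * k) m).filter fun F => 0 ∉ F).card ≤
      (j + 3 * (k - j) - 1).choose (3 * (k - j)) := by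
  intro
  have hℓ : 3 ≤ 3 * k := by omega
  rw [← Finset.card_range j, ← card_piAntidiag_nat, Finset.card_range]
  have key : ∀ F ∈ (doubleCovers 3 (3 * k) m).filter fun F => 0 ∉ F,
      Fᶜ.Nonempty ∧ cyclicEnum Fᶜ 0 = 0 ∧ (∀ n, cyclicEnum Fᶜ (n + j) = cyclicEnum Fᶜ n + 3 * k) ∧
      ∀ n, cyclicEnum Fᶜ n + 3 ≤ cyclicEnum Fᶜ (n + 1) := by
    intro F hF
    obtain ⟨hF1, h0⟩ := Finset.mem_filter.1 hF
    obtain ⟨hc, hcard⟩ := mem_doubleCovers.1 hF1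
    have h0' : (0 : Fin (3 * k)) ∈ Fᶜ := Finset.mem_compl.2 h0
    have hne : Fᶜ.Nonempty := ⟨0, h0'⟩
    have hcj : Fᶜ.card = j := by
      rw [Finset.card_compl, Fintype.card_fin, hcard]
      omega
    exact ⟨hne, cyclicEnum_zero h0', fun n => hcj ▸ cyclicEnum_add_card hne n,
      cyclicEnum_compl_add_three_le hℓ hc hne⟩
  have hsum : ∀ F ∈ (doubleCovers 3 (3 * k) m).filter fun F => 0 ∉ F, ∀ n ≤ j,
      ∑ i ∈ Finset.range n, (if i < j then cyclicEnum Fᶜ (i + 1) - cyclicEnum Fᶜ i - 3 else 0) +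
        3 * n = cyclicEnum Fᶜ n := by
    intro F hF n hn
    obtain ⟨-, h0, -, h3⟩ := key F hF
    induction n with
    | zero => simp [h0]
    | succ n ih =>
      have h4 := h3 n
      have h5 := ih (by omega)
      rw [Finset.sum_range_succ, if_pos (by omega)]
      omega
  refine Finset.card_le_card_of_injOn
    (fun F i => if i < j then cyclicEnum Fᶜ (i + 1) - cyclicEnum Fᶜ i - 3 else 0) ?_ ?_
  · intro F hF
    obtain ⟨-, h0, hper, -⟩ := key F hF
    have h1 := hsum F hF j le_rfl
    have h2 := hper 0
    rw [zero_add, h0] at h2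
    refine Finset.mem_piAntidiag.2 ⟨?_, fun i hi => ?_⟩
    · change ∑ i ∈ Finset.range j,
        (if i < j then cyclicEnum Fᶜ (i + 1) - cyclicEnum Fᶜ i - 3 else 0) = _
      omega
    by_contra hij
    rw [Finset.mem_range] at hij
    simp [hij] at hi
  · intro F hF G hG hFG
    obtain ⟨hneF, -, hper, -⟩ := key F hF
    obtain ⟨hneG, -, hper', -⟩ := key G hG
    refine compl_injective
      (cyclicEnum_injOn hneF hneG (cyclic_seq_ext hj hper hper' fun n hn => ?_))
    rw [← hsum F hF n hn.le, ← hsum G hG n hn.le]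
    congr 1
    exact Finset.sum_congr rfl fun i _ => congrFun hFG i

/-- For `r = 3`, counting the sets of vertices that do not start an edge gives a sharper bound than
the two-step increments. -/
theorem card_doubleCovers_three_le (hk : 0 < k) {t : ℕ} (ht : 0 < t) :
    ((doubleCovers 3 (3 * k) (2 * (k + t))).card : ℝ) ≤
      k / (2 * t) * (k + 4 * t - 1).choose (6 * t - 1) := by
  have ht' : (0 : ℝ) < t := by exact_mod_cast ht
  rcases lt_trichotomy k (2 * t) with h | h | h
  · have : doubleCovers 3 (3 * k) (2 * (k + t)) = ∅ := by
      rw [Finset.eq_empty_iff_forall_notMem]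
      intro F hF
      have h1 := F.card_le_univ
      rw [Fintype.card_fin, (mem_doubleCovers.1 hF).2] at h1
      omega
    rw [this]
    simp only [Finset.card_empty, Nat.cast_zero]
    positivity
  · have h1 : (doubleCovers 3 (3 * k) (2 * (k + t))).card ≤ 1 := by
      rw [Finset.card_le_one]
      have huniv : ∀ F ∈ doubleCovers 3 (3 * k) (2 * (k + t)), F = Finset.univ := by
        intro F hF
        rw [← Finset.card_eq_iff_eq_univ, Fintype.card_fin, (mem_doubleCovers.1 hF).2]
        omega
      intro F hF G hG
      rw [huniv F hF, huniv G hG]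
    have h2 : k + 4 * t - 1 = 6 * t - 1 := by omega
    have h3 : (k : ℝ) = 2 * t := by exact_mod_cast h
    rw [h2, Nat.choose_self, h3, div_self (by positivity)]
    exact_mod_cast h1
  · have : NeZero (3 * k) := ⟨by omega⟩
    have h1 := mul_card_doubleCovers_filter_notMem (r := 3) (ℓ := 3 * k) (by omega) (2 * (k + t))
    have h2 := card_doubleCovers_three_filter_le (k := k) (j := k - 2 * t) (m := 2 * (k + t))
      (by omega) (by omega)
    rw [show k - 2 * t + 3 * (k - (k - 2 * t)) - 1 = k + 4 * t - 1 by omega,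
      show 3 * (k - (k - 2 * t)) = 6 * t by omega] at h2
    rw [show 3 * k - 2 * (k + t) = k - 2 * t by omega] at h1
    have h3 := Nat.choose_succ_right_eq (k + 4 * t - 1) (6 * t - 1)
    rw [show 6 * t - 1 + 1 = 6 * t by omega,
      show k + 4 * t - 1 - (6 * t - 1) = k - 2 * t by omega] at h3
    have h4 : (k - 2 * t) * (2 * t * (doubleCovers 3 (3 * k) (2 * (k + t))).card) ≤
        (k - 2 * t) * (k * (k + 4 * t - 1).choose (6 * t - 1)) := by
      calc _ = 2 * t * ((k - 2 * t) * (doubleCovers 3 (3 * k) (2 * (k + t))).card) := by ring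
        _ ≤ 2 * t * (3 * k * (k + 4 * t - 1).choose (6 * t)) := by
          rw [h1]
          gcongr
        _ = k * ((k + 4 * t - 1).choose (6 * t) * (6 * t)) := by ring
        _ = _ := by rw [h3]; ring
    have h5 := Nat.le_of_mul_le_mul_left h4 (by omega)
    have h6 : (2 * t * (doubleCovers 3 (3 * k) (2 * (k + t))).card : ℝ) ≤
        k * (k + 4 * t - 1).choose (6 * t - 1) := by exact_mod_cast h5
    rw [div_mul_eq_mul_div, le_div_iff₀ (by positivity)]
    linarith

theorem choose_ratio_three (hk : 1 ≤ k) {t : ℕ} (ht : 1 ≤ t) :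
    332640 * ((k + 4 * (t + 1) - 1).choose (6 * (t + 1) - 1)) ≤
      81 * (k + 1) ^ 4 * k ^ 2 * (k + 4 * t - 1).choose (6 * t - 1) := by
  obtain ⟨s, rfl⟩ := Nat.exists_eq_add_of_le' ht
  obtain ⟨N, hN⟩ : ∃ N, N = k + 4 * s + 3 := ⟨_, rfl⟩
  obtain ⟨M, hM⟩ : ∃ M, M = 6 * s + 5 := ⟨_, rfl⟩
  rw [show k + 4 * (s + 1 + 1) - 1 = N + 4 by omega, show k + 4 * (s + 1) - 1 = N by omega,
    show 6 * (s + 1 + 1) - 1 = M + 6 by omega, show 6 * (s + 1) - 1 = M by omega]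
  have h1 := Nat.add_one_mul_choose_eq N M
  have h2 := Nat.add_one_mul_choose_eq (N + 1) (M + 1)
  have h3 := Nat.add_one_mul_choose_eq (N + 2) (M + 2)
  have h4 := Nat.add_one_mul_choose_eq (N + 3) (M + 3)
  have h5 := Nat.choose_succ_right_eq (N + 4) (M + 4)
  have h6 := Nat.choose_succ_right_eq (N + 4) (M + 5)
  have h7 : N + 4 - (M + 4) ≤ k := by omega
  have h8 : N + 4 - (M + 5) ≤ k := by omega
  have e1 : (N + 4).choose (M + 6) * ((M + 1) * (M + 2) * (M + 3) * (M + 4) * (M + 5) * (M + 6)) ≤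
      k ^ 2 * ((N + 1) * (N + 2) * (N + 3) * (N + 4)) * N.choose M := by
    calc (N + 4).choose (M + 6) * ((M + 1) * (M + 2) * (M + 3) * (M + 4) * (M + 5) * (M + 6))
        = ((N + 4).choose (M + 5 + 1) * (M + 5 + 1)) *
          ((M + 1) * (M + 2) * (M + 3) * (M + 4) * (M + 5)) := by ring
      _ ≤ ((N + 4).choose (M + 5) * k) * ((M + 1) * (M + 2) * (M + 3) * (M + 4) * (M + 5)) := by
          rw [h6]; gcongr
      _ = ((N + 4).choose (M + 4 + 1) * (M + 4 + 1)) * k *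
          ((M + 1) * (M + 2) * (M + 3) * (M + 4)) := by ring
      _ ≤ ((N + 4).choose (M + 4) * k) * k * ((M + 1) * (M + 2) * (M + 3) * (M + 4)) := by
          rw [h5]; gcongr
      _ = k ^ 2 * ((N + 3 + 1).choose (M + 3 + 1) * (M + 3 + 1)) *
          ((M + 1) * (M + 2) * (M + 3)) := by ring
      _ = k ^ 2 * (N + 4) * ((N + 2 + 1).choose (M + 2 + 1) * (M + 2 + 1)) *
          ((M + 1) * (M + 2)) := by rw [← h4]; ring
      _ = k ^ 2 * (N + 3) * (N + 4) * ((N + 1 + 1).choose (M + 1 + 1) * (M + 1 + 1)) *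
          (M + 1) := by rw [← h3]; ring
      _ = k ^ 2 * (N + 2) * (N + 3) * (N + 4) * ((N + 1).choose (M + 1) * (M + 1)) := by
          rw [← h2]; ring
      _ = _ := by rw [← h1]; ring
  have e2 : 332640 ≤ (M + 1) * (M + 2) * (M + 3) * (M + 4) * (M + 5) * (M + 6) := by
    calc 332640 = (5 + 1) * (5 + 2) * (5 + 3) * (5 + 4) * (5 + 5) * (5 + 6) := by norm_num
      _ ≤ _ := by
        have : 5 ≤ M := by omega
        gcongr
  rcases Nat.lt_or_ge N M with hNM | hNM
  · rw [Nat.choose_eq_zero_of_lt hNM, mul_zero, Nat.le_zero] at e1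
    have : (N + 4).choose (M + 6) = 0 := by
      rcases Nat.mul_eq_zero.1 e1 with h | h
      · exact h
      · omega
    simp [this]
  · have e3 : (N + 1) * (N + 2) * (N + 3) * (N + 4) ≤ 81 * (k + 1) ^ 4 := by
      calc (N + 1) * (N + 2) * (N + 3) * (N + 4)
          ≤ (3 * (k + 1)) * (3 * (k + 1)) * (3 * (k + 1)) * (3 * (k + 1)) := by
            gcongr <;> omega
        _ = _ := by ring
    calc 332640 * (N + 4).choose (M + 6)
        ≤ (M + 1) * (M + 2) * (M + 3) * (M + 4) * (M + 5) * (M + 6) * (N + 4).choose (M + 6) := by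
          gcongr
      _ ≤ k ^ 2 * ((N + 1) * (N + 2) * (N + 3) * (N + 4)) * N.choose M := by
          rw [mul_comm]; exact e1
      _ ≤ k ^ 2 * (81 * (k + 1) ^ 4) * N.choose M := by gcongr
      _ = _ := by ring

theorem oddBound_three (k : ℕ) : oddBound 3 k = k ^ 2 * (k + 1) / 2 := by
  have c3 := choose_three_real (2 * k)
  push_cast at c3
  rw [oddBound, c3, show k + 3 - 1 = k + 2 by omega, show 3 - 1 = 2 by norm_num,
    choose_two_real]
  push_cast
  field_simp
  ring

theorem not_isSidorenko_three (hk : 2 ≤ k) (hℓ : 3 < 3 * k) :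
    ¬ (tightCycle 3 (3 * k) hℓ.le).IsSidorenko := by
  have hk' : (2 : ℝ) ≤ k := by exact_mod_cast hk
  have hk0 : (0 : ℝ) < k := by linarith
  have h2 := oddBound_le (r := 3) (k := k) (by norm_num) (by omega)
  rw [oddBound_three] at h2
  have hp : ((3 : ℕ) * ((3 : ℕ) - 1) : ℝ) ≤ k ^ 2 * (k + 1) / 2 := by
    push_cast
    nlinarith [mul_nonneg (sub_nonneg.2 hk') (sub_nonneg.2 hk')]
  refine not_isSidorenko_of_even_lt (by norm_num) (by omega) hp h2 ?_ hℓ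
  set c : ℝ := (3 : ℕ) * ((3 : ℕ) - 1) / (k ^ 2 * (k + 1) / 2) with hc
  have hc' : c = 12 / (k ^ 2 * (k + 1)) := by
    rw [hc]
    push_cast
    field_simp
    norm_num
  have hc0 : 0 ≤ c := by rw [hc']; positivity
  let x : ℕ → ℝ := fun t => k / (2 * t) * (k + 4 * t - 1).choose (6 * t - 1) * c ^ (2 * t)
  have hx : ∀ t, 0 ≤ x t := fun t => by positivity
  have hratio : ∀ t, 1 ≤ t → x (t + 1) ≤ 1 / 2 * x t := by
    intro t ht
    have h3 := choose_ratio_three (k := k) (by omega) ht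
    have h3' : 332640 * ((k + 4 * (t + 1) - 1).choose (6 * (t + 1) - 1) : ℝ) ≤
        81 * (k + 1) ^ 4 * k ^ 2 * (k + 4 * t - 1).choose (6 * t - 1) := by exact_mod_cast h3
    have ht0 : (0 : ℝ) < t := by exact_mod_cast ht
    have h4 : 81 * (k + 1 : ℝ) ^ 4 * k ^ 2 * c ^ 2 ≤ 332640 * (1 / 2) := by
      have h5 : 81 * (k + 1 : ℝ) ^ 4 * k ^ 2 * c ^ 2 = 11664 * ((k + 1) / k) ^ 2 := by
        rw [hc']
        field_simp
        norm_num
      have h6 : ((k + 1 : ℝ) / k) ≤ 2 := by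
        rw [div_le_iff₀ hk0]
        linarith
      rw [h5]
      have : ((k + 1 : ℝ) / k) ^ 2 ≤ 2 ^ 2 := by gcongr
      linarith
    have h7 : ((k + 4 * (t + 1) - 1).choose (6 * (t + 1) - 1) : ℝ) * c ^ 2 ≤
        1 / 2 * (k + 4 * t - 1).choose (6 * t - 1) := by
      have h8 := mul_le_mul_of_nonneg_right h3' (sq_nonneg c)
      have h9 := mul_le_mul_of_nonneg_right h4
        (Nat.cast_nonneg (α := ℝ) ((k + 4 * t - 1).choose (6 * t - 1)))
      nlinarith
    calc x (t + 1) = k / (2 * (t + 1 : ℕ)) *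
          ((k + 4 * (t + 1) - 1).choose (6 * (t + 1) - 1) * c ^ 2) * c ^ (2 * t) := by
          simp only [x]
          ring
      _ ≤ k / (2 * t) * (1 / 2 * (k + 4 * t - 1).choose (6 * t - 1)) * c ^ (2 * t) := by
          gcongr
          omega
      _ = 1 / 2 * x t := by
          simp only [x]
          ring
  have hx1 : x 1 ≤ 6 / 5 := by
    have c5 : ((k + 3).choose 5 : ℝ) = (k - 1) * k * (k + 1) * (k + 2) * (k + 3) / 120 := by
      obtain ⟨s, rfl⟩ := Nat.exists_eq_add_of_le' hk
      have h := choose_five_real s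
      push_cast at h ⊢
      rw [show s + 2 + 3 = s + 5 by ring, h]
      ring
    have h3 : x 1 = 3 * ((k - 1) * (k + 2) * (k + 3)) / (5 * (k ^ 2 * (k + 1))) := by
      simp only [x]
      rw [show k + 4 * 1 - 1 = k + 3 by omega, show 6 * 1 - 1 = 5 by norm_num, c5, hc']
      push_cast
      field_simp
      ring
    rw [h3, div_le_iff₀ (by positivity)]
    nlinarith [mul_nonneg (sub_nonneg.2 hk') (sub_nonneg.2 hk'),
      mul_nonneg (mul_nonneg (sub_nonneg.2 hk') (sub_nonneg.2 hk')) hk0.le]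
  calc ∑ t ∈ Finset.Icc 1 (3 * k), ((doubleCovers 3 (3 * k) (2 * (k + t))).card : ℝ) * c ^ (2 * t)
      ≤ ∑ t ∈ Finset.Icc 1 (3 * k), x t := by
        refine Finset.sum_le_sum fun t ht => ?_
        have ht1 := (Finset.mem_Icc.1 ht).1
        simp only [x]
        gcongr
        exact card_doubleCovers_three_le (by omega) ht1
    _ ≤ x 1 / (1 - 1 / 2) := sum_Icc_le_of_ratio (by norm_num) hx hratio _
    _ < (3 : ℕ) * ((3 : ℕ) - 1) / 2 := by
        rw [div_lt_iff₀ (by norm_num)]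
        push_cast
        linarith

end Three

/-! ### Comparison with consecutive blocks -/

section Blocks

variable {r k : ℕ}

/-- The trace of a set of residues modulo `r k` on the `i`-th block of `r` consecutive residues. -/
def blockTrace (r k : ℕ) [NeZero (r * k)] (F : Finset (Fin (r * k))) (i : Fin k) :
    Finset (Fin r) :=
  Finset.univ.filter fun j => Fin.ofNat (r * k) (r * i + j) ∈ F

theorem card_blockTrace [NeZero (r * k)] (F : Finset (Fin (r * k))) (i : Fin k) :
    (blockTrace r k F i).card =
      Nat.count (fun j => Fin.ofNat (r * k) (r * i + j) ∈ F) r := by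
  rw [Nat.count_eq_card_filter_range, blockTrace, Finset.card_filter,
    Finset.card_filter]
  exact Fin.sum_univ_eq_sum_range
    (fun j => if Fin.ofNat (r * k) (r * i + j) ∈ F then 1 else 0) r

theorem sum_card_blockTrace [NeZero (r * k)] (F : Finset (Fin (r * k))) :
    ∑ i, (blockTrace r k F i).card = F.card := by
  rw [← count_ofNat_mem F]
  simp only [card_blockTrace]
  rw [Fin.sum_univ_eq_sum_range
    (fun i => Nat.count (fun j => Fin.ofNat (r * k) (r * i + j) ∈ F) r)]
  have h : ∀ n, ∑ i ∈ Finset.range n, Nat.count (fun j => Fin.ofNat (r * k) (r * i + j) ∈ F) r =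
      Nat.count (fun x => Fin.ofNat (r * k) x ∈ F) (r * n) := by
    intro n
    induction n with
    | zero => simp
    | succ n ih => rw [Finset.sum_range_succ, ih, Nat.mul_succ, Nat.count_add]
  exact h k

/-- The last vertex of a block lies exactly in the edges that start in this block. -/
theorem two_le_card_blockTrace [NeZero (r * k)] {F : Finset (Fin (r * k))} (hr : r ≤ r * k)
    (hF : IsDoubleCover r F) (i : Fin k) : 2 ≤ (blockTrace r k F i).card := by
  have hpos : 0 < r * k := Nat.pos_of_neZero _
  have h := count_add_cycleDegree hr F (r * i + r * k - 1)
  have h2 := hF (Fin.ofNat (r * k) (r * i + r * k - 1 + r))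
  rw [show r * i + r * k - 1 + 1 = r * i + r * k by omega, Nat.count_add] at h
  have h3 : ∀ j, Fin.ofNat (r * k) (r * i + r * k + j) = Fin.ofNat (r * k) (r * i + j) := by
    intro j
    rw [show r * i + r * k + j = r * i + j + r * k by ring, ofNat_add_self]
  simp only [h3] at h
  rw [card_blockTrace]
  omega

theorem blockTrace_injective [NeZero (r * k)] :
    Function.Injective (blockTrace r k) := by
  intro F G h
  have hrk : 0 < r * k := Nat.pos_of_neZero _
  have hr : 0 < r := Nat.pos_of_mul_pos_right hrk
  ext v
  have hv : v.val / r < k := Nat.div_lt_of_lt_mul v.2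
  have h1 := congrFun h ⟨v.val / r, hv⟩
  have h2 := Finset.ext_iff.1 h1 ⟨v.val % r, Nat.mod_lt _ hr⟩
  simp only [blockTrace, Finset.mem_filter, Finset.mem_univ, true_and, Nat.div_add_mod] at h2
  rwa [ofNat_val_self] at h2

theorem sum_card_eq_pow (c : ℝ) (s : ℕ) :
    ∑ S : Finset (Fin r), (if S.card = s then c ^ S.card else 0) = r.choose s * c ^ s := by
  rw [← Finset.sum_filter, Finset.sum_congr rfl fun S hS => by rw [(Finset.mem_filter.1 hS).2],
    Finset.sum_const, nsmul_eq_mul]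
  congr 2
  have := Finset.card_powersetCard s (Finset.univ : Finset (Fin r))
  rw [Finset.card_univ, Fintype.card_fin] at this
  rw [← this, ← Finset.powerset_univ, Finset.powersetCard_eq_filter]

theorem sum_two_le_card_pow (c : ℝ) :
    ∑ S : Finset (Fin r), (if 2 ≤ S.card then c ^ S.card else 0) = (1 + c) ^ r - 1 - r * c := by
  have h : ∀ S : Finset (Fin r), (if 2 ≤ S.card then c ^ S.card else 0) =
      c ^ S.card - (if S.card = 0 then c ^ S.card else 0) -
        (if S.card = 1 then c ^ S.card else 0) := by
    intro S
    split_ifs <;> first | omega | simp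
  simp only [h]
  rw [Finset.sum_sub_distrib, Finset.sum_sub_distrib, sum_card_eq_pow, sum_card_eq_pow]
  have h2 := Finset.prod_one_add (f := fun _ : Fin r => c) (s := Finset.univ)
  simp only [Finset.prod_const, Finset.card_univ, Fintype.card_fin, Finset.powerset_univ] at h2
  rw [← h2]
  simp

/-- Among families of sets with at least two elements each, those of minimal total size and those
with one more element are split off. -/
theorem prod_add_prod_add_sum_le {c : ℝ} (hc : 0 ≤ c) (g : Fin k → ℕ) :
    (if 2 * k + 2 ≤ ∑ i, g i then ∏ i, (if 2 ≤ g i then c ^ g i else 0) else 0) +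
      ∏ i, (if g i = 2 then c ^ g i else 0) +
      ∑ i, ∏ j, (if g j = (if j = i then 3 else 2) then c ^ g j else 0) ≤
    ∏ i, (if 2 ≤ g i then c ^ g i else 0) := by
  have hnn : 0 ≤ ∏ i, (if 2 ≤ g i then c ^ g i else 0) :=
    Finset.prod_nonneg fun i _ => by split_ifs <;> positivity
  have hsum2 : (∀ i, g i = 2) → ∑ i, g i = 2 * k := by
    intro h
    simp [h, mul_comm]
  have hsum3 : ∀ i, (∀ j, g j = if j = i then 3 else 2) → ∑ j, g j = 2 * k + 1 := by
    intro i h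
    have h1 : ∀ j, g j = 2 + if j = i then 1 else 0 := by
      intro j
      rw [h j]
      split_ifs <;> rfl
    simp [h1, Finset.sum_add_distrib, mul_comm]
  have hzero : ∀ s : Fin k → ℕ, ¬ (∀ j, g j = s j) →
      ∏ j, (if g j = s j then c ^ g j else 0) = 0 := by
    intro s h
    push Not at h
    obtain ⟨j, hj⟩ := h
    exact Finset.prod_eq_zero (Finset.mem_univ j) (by simp [hj])
  by_cases h2 : ∀ i, g i = 2
  · have h3 : ∑ i, ∏ j, (if g j = (if j = i then 3 else 2) then c ^ g j else 0) = 0 :=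
      Finset.sum_eq_zero fun i _ => hzero _ fun h => by simpa [h2 i] using h i
    rw [h3, hsum2 h2, if_neg (by omega)]
    simp [h2]
  · rw [hzero _ h2, add_zero]
    by_cases h3 : ∃ i, ∀ j, g j = if j = i then 3 else 2
    · obtain ⟨i, hi⟩ := h3
      rw [hsum3 i hi, if_neg (by omega), zero_add, Finset.sum_eq_single i]
      · refine Finset.prod_le_prod (fun j _ => by split_ifs <;> positivity) fun j _ => ?_
        have h4 : 2 ≤ g j := by
          rw [hi j]
          split_ifs <;> omega
        rw [if_pos (hi j), if_pos h4]
      · intro i' _ hne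
        refine hzero _ fun h => ?_
        have h5 := h i'
        have h6 := hi i'
        rw [if_pos rfl] at h5
        rw [if_neg hne] at h6
        omega
      · simp
    · push Not at h3
      have h4 : ∑ i, ∏ j, (if g j = (if j = i then 3 else 2) then c ^ g j else 0) = 0 :=
        Finset.sum_eq_zero fun i _ => hzero _ fun h => by
          obtain ⟨j, hj⟩ := h3 i
          exact hj (h j)
      rw [h4, add_zero]
      split_ifs
      · exact le_rfl
      · exact hnn

/-- A double cover has at least two members in each of the `k` blocks, so that the generating
function of the covers is dominated by the `k`-th power of that of a single block. -/
theorem sum_doubleCover_le_blocks (hr : 0 < r) (hk : 0 < k) {c : ℝ} (hc : 0 ≤ c) :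
    ∑ F : Finset (Fin (r * k)) with IsDoubleCover r F ∧ 2 * k + 2 ≤ F.card, c ^ F.card ≤
      ((1 + c) ^ r - 1 - r * c) ^ k - (r.choose 2 * c ^ 2) ^ k -
        k * (r.choose 3 * c ^ 3 * (r.choose 2 * c ^ 2) ^ (k - 1)) := by
  have : NeZero (r * k) := ⟨(Nat.mul_pos hr hk).ne'⟩
  have hle : r ≤ r * k := Nat.le_mul_of_pos_right r hk
  have hpi : ∀ f : Fin k → Finset (Fin r) → ℝ,
      ∑ g : Fin k → Finset (Fin r), ∏ i, f i (g i) = ∏ i, ∑ S, f i S := by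
    intro f
    rw [Finset.prod_univ_sum, Fintype.piFinset_univ]
  have h1 := Finset.sum_le_sum fun (g : Fin k → Finset (Fin r)) (_ : g ∈ Finset.univ) =>
    prod_add_prod_add_sum_le hc fun i => (g i).card
  rw [Finset.sum_add_distrib, Finset.sum_add_distrib, Finset.sum_comm] at h1
  rw [hpi fun _ S => if S.card = 2 then c ^ S.card else 0,
    hpi fun _ S => if 2 ≤ S.card then c ^ S.card else 0] at h1
  rw [Finset.sum_congr rfl fun i _ => hpi fun j S =>
    if S.card = (if j = i then 3 else 2) then c ^ S.card else 0] at h1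
  simp only [sum_card_eq_pow, sum_two_le_card_pow, Finset.prod_const, Finset.card_univ,
    Fintype.card_fin] at h1
  have h2 : ∀ i : Fin k, ∏ j : Fin k, ((r.choose (if j = i then 3 else 2) : ℝ) *
      c ^ (if j = i then 3 else 2)) = r.choose 3 * c ^ 3 * (r.choose 2 * c ^ 2) ^ (k - 1) := by
    intro i
    rw [← Finset.mul_prod_erase _ _ (Finset.mem_univ i), if_pos rfl,
      Finset.prod_congr rfl fun j hj => by rw [if_neg (Finset.ne_of_mem_erase hj)],
      Finset.prod_const, Finset.card_erase_of_mem (Finset.mem_univ i), Finset.card_univ,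
      Fintype.card_fin]
  simp only [h2, Finset.sum_const, Finset.card_univ, Fintype.card_fin, nsmul_eq_mul] at h1
  refine le_trans ?_ (show ∑ g : Fin k → Finset (Fin r),
    (if 2 * k + 2 ≤ ∑ i, (g i).card then
      ∏ i, (if 2 ≤ (g i).card then c ^ (g i).card else 0) else 0) ≤ _ by linarith)
  refine le_trans (le_of_eq ?_) (Finset.sum_le_sum_of_subset_of_nonneg
    (s := (Finset.univ.filter fun F : Finset (Fin (r * k)) =>
      IsDoubleCover r F ∧ 2 * k + 2 ≤ F.card).image (blockTrace r k))
    (Finset.subset_univ _) fun g _ _ => ?_)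
  · rw [Finset.sum_image fun F _ G _ h => blockTrace_injective h]
    refine Finset.sum_congr rfl fun F hF => ?_
    obtain ⟨hF1, hF2⟩ := (Finset.mem_filter.1 hF).2
    rw [sum_card_blockTrace, if_pos hF2,
      Finset.prod_congr rfl fun i _ => if_pos (two_le_card_blockTrace hle hF1 i),
      Finset.prod_pow_eq_pow_sum, sum_card_blockTrace]
  · split_ifs
    · exact Finset.prod_nonneg fun i _ => by split_ifs <;> positivity
    · exact le_rfl

theorem sum_even_le_blocks (hr : 0 < r) (hk : 0 < k) {c : ℝ} (hc : 0 < c) (n : ℕ) :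
    ∑ t ∈ Finset.Icc 1 n, (doubleCovers r (r * k) (2 * (k + t))).card * c ^ (2 * t) ≤
      (((1 + c) ^ r - 1 - r * c) / c ^ 2) ^ k - r.choose 2 ^ k -
        k * (r.choose 3 * c * r.choose 2 ^ (k - 1)) := by
  have h1 : ∑ t ∈ Finset.Icc 1 n,
      ((doubleCovers r (r * k) (2 * (k + t))).card : ℝ) * c ^ (2 * (k + t)) ≤
      ∑ F : Finset (Fin (r * k)) with IsDoubleCover r F ∧ 2 * k + 2 ≤ F.card, c ^ F.card := by
    have h2 : ∀ t, ((doubleCovers r (r * k) (2 * (k + t))).card : ℝ) * c ^ (2 * (k + t)) =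
        ∑ F ∈ doubleCovers r (r * k) (2 * (k + t)), c ^ F.card := by
      intro t
      rw [Finset.sum_congr rfl fun F hF => by rw [(mem_doubleCovers.1 hF).2], Finset.sum_const,
        nsmul_eq_mul]
    simp only [h2]
    rw [← Finset.sum_biUnion]
    · refine Finset.sum_le_sum_of_subset_of_nonneg ?_ fun F _ _ => by positivity
      intro F hF
      obtain ⟨t, ht, hF⟩ := Finset.mem_biUnion.1 hF
      obtain ⟨hF1, hF2⟩ := mem_doubleCovers.1 hF
      have ht1 := (Finset.mem_Icc.1 ht).1
      exact Finset.mem_filter.2 ⟨Finset.mem_univ _, hF1, by omega⟩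
    · intro s _ t _ hst
      refine Finset.disjoint_left.2 fun F hF hF' => hst ?_
      have h3 := (mem_doubleCovers.1 hF).2
      have h4 := (mem_doubleCovers.1 hF').2
      omega
  have h5 := h1.trans (sum_doubleCover_le_blocks hr hk hc.le)
  have hck : 0 < c ^ (2 * k) := by positivity
  refine le_of_mul_le_mul_right ?_ hck
  rw [Finset.sum_mul]
  have h6 : ∀ t, ((doubleCovers r (r * k) (2 * (k + t))).card : ℝ) * c ^ (2 * t) * c ^ (2 * k) =
      (doubleCovers r (r * k) (2 * (k + t))).card * c ^ (2 * (k + t)) := by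
    intro t
    rw [mul_assoc, ← pow_add, mul_add, add_comm (2 * t)]
  simp only [h6]
  refine h5.trans (le_of_eq ?_)
  obtain ⟨m, rfl⟩ := Nat.exists_eq_add_of_le' hk
  rw [Nat.add_sub_cancel, div_pow, sub_mul, sub_mul, pow_mul, div_mul_cancel₀ _ (by positivity)]
  ring

end Blocks

section BlockCases

/-- A binomial expansion up to order three, where the term of order four also accounts for the
terms of higher order. -/
theorem one_add_pow_le {c : ℝ} (hc : 0 ≤ c) (s : ℕ) (hs : 5 * (s : ℝ) * c ≤ 2) :
    (1 + c) ^ (s + 3) ≤ 1 + (s + 3) * c + (s + 2) * (s + 3) / 2 * c ^ 2 +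
      (s + 1) * (s + 2) * (s + 3) / 6 * c ^ 3 +
      10 / 9 * (s * (s + 1) * (s + 2) * (s + 3) / 24) * c ^ 4 := by
  induction s with
  | zero => norm_num; nlinarith
  | succ s ih =>
    push_cast at hs ⊢
    have h1 := ih (by nlinarith)
    rw [show s + 1 + 3 = s + 3 + 1 by ring, pow_succ]
    refine (mul_le_mul_of_nonneg_right h1 (by linarith)).trans ?_
    have h2 : 0 ≤ ((s + 1) * (s + 2) * (s + 3) * c ^ 4 : ℝ) := by positivity
    have h3 : 0 ≤ (2 - 5 * (s : ℝ) * c) := by nlinarith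
    nlinarith [mul_nonneg h2 h3]

theorem oddBound_two {r : ℕ} (hr : 5 ≤ r) :
    oddBound r 2 = r * (r - 1) * ((r + 1) * (r + 12) * (r - 2)) / 60 := by
  obtain ⟨s, rfl⟩ := Nat.exists_eq_add_of_le hr
  have h1 : (2 * 2 + (5 + s)).choose (5 + s) = (5 + s + 4).choose 4 := by
    rw [show 2 * 2 + (5 + s) = 5 + s + 4 by ring, ← Nat.choose_symm_add]
  have h2 : (2 + (5 + s) - 1).choose (5 + s - 1) = (4 + s + 2).choose 2 := by
    rw [show 2 + (5 + s) - 1 = 4 + s + 2 by omega, show 5 + s - 1 = 4 + s by omega,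
      ← Nat.choose_symm_add]
  rw [oddBound, h1, h2, choose_four_real, choose_two_real]
  push_cast
  ring

theorem not_isSidorenko_two {r : ℕ} (hr : 5 ≤ r) (hℓ : r < r * 2) :
    ¬ (tightCycle r (r * 2) hℓ.le).IsSidorenko := by
  have hodd := oddBound_le (r := r) (k := 2) (by omega) (by norm_num)
  have hr5 : (5 : ℝ) ≤ r := by exact_mod_cast hr
  rw [oddBound_two hr] at hodd
  set p : ℝ := r * (r - 1) * ((r + 1) * (r + 12) * (r - 2)) / 60 with hp
  set q : ℝ := (r + 1) * (r + 12) * (r - 2) with hq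
  have hrr : (0 : ℝ) < r * (r - 1) := mul_pos (by linarith) (by linarith)
  have hq60 : 60 ≤ q := by
    have h1 : (6 : ℝ) * 17 * 3 ≤ (r + 1) * (r + 12) * (r - 2) := by
      gcongr <;> linarith
    linarith
  have hpq : p = r * (r - 1) * (q / 60) := by rw [hp]; ring
  refine not_isSidorenko_of_even_lt (by omega) (by norm_num) (p := p) ?_ hodd ?_ hℓ
  · rw [hpq]
    exact le_mul_of_one_le_right hrr.le (by linarith)
  have hc : r * (r - 1) / p = 60 / q := by
    rw [hpq]
    have : q ≠ 0 := by linarith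
    have h1 : (r : ℝ) ≠ 0 := by linarith
    have h2 : (r : ℝ) - 1 ≠ 0 := by linarith
    field_simp
  rw [hc]
  set c : ℝ := 60 / q with hcdef
  have hc0 : 0 < c := div_pos (by norm_num) (by linarith)
  refine (sum_even_le_blocks (by omega) (by norm_num) hc0 _).trans_lt ?_
  obtain ⟨s, rfl⟩ := Nat.exists_eq_add_of_le' (show 3 ≤ r by omega)
  have hs : (2 : ℝ) ≤ s := by push_cast at hr5; linarith
  have hcq : c * q = 60 := div_mul_cancel₀ _ (by linarith)
  have hcs : 5 * (s : ℝ) * c ≤ 2 := by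
    rw [hcdef, ← mul_div_assoc, div_le_iff₀ (by linarith), hq]
    push_cast
    have h0 := mul_nonneg (sub_nonneg.2 hs) (sub_nonneg.2 hs)
    nlinarith [h0, mul_nonneg h0 (show (0 : ℝ) ≤ s by linarith)]
  have hT := one_add_pow_le hc0.le s hcs
  have h2 : ((s + 3).choose 2 : ℝ) = (s + 2) * (s + 3) / 2 := by
    have := choose_two_real (s + 1)
    push_cast at this
    rw [this]
    ring
  rw [h2, choose_three_real]
  have hτ : ((1 + c) ^ (s + 3) - 1 - (s + 3 : ℕ) * c) / c ^ 2 ≤ (s + 2) * (s + 3) / 2 +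
      (s + 1) * (s + 2) * (s + 3) / 6 * c +
      10 / 9 * (s * (s + 1) * (s + 2) * (s + 3) / 24) * c ^ 2 := by
    rw [div_le_iff₀ (by positivity)]
    push_cast
    nlinarith
  have hτ0 : 0 ≤ ((1 + c) ^ (s + 3) - 1 - (s + 3 : ℕ) * c) / c ^ 2 := by
    refine div_nonneg ?_ (by positivity)
    have := one_add_mul_le_pow (show -2 ≤ c by linarith) (s + 3)
    linarith
  have hτ2 := pow_le_pow_left₀ hτ0 hτ 2
  refine (sub_le_sub_right (sub_le_sub_right hτ2 _) _).trans_lt ?_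
  have hqs : q = (s + 4) * (s + 15) * (s + 1) := by
    rw [hq]
    push_cast
    ring
  have hc' : c = 60 / ((s + 4) * (s + 15) * (s + 1)) := by rw [hcdef, hqs]
  push_cast
  obtain ⟨u, rfl⟩ := Nat.exists_eq_add_of_le' (show 2 ≤ s by omega)
  rw [hc', ← sub_pos]
  push_cast
  have hu : (0 : ℝ) ≤ u := Nat.cast_nonneg u
  field_simp
  ring_nf
  positivity

end BlockCases

section BlockCases

/-- The comparison with blocks for a single pair `(r, k)`, with the binomial coefficients
evaluated. -/
theorem not_isSidorenko_of_blocks {r k : ℕ} (D E : ℕ) (p : ℝ) (hr : 1 < r) (hk : 1 < k)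
    (hD : (2 * k + r).choose r = D) (hE : (k + r - 1).choose (r - 1) = E)
    (hp : (r * k / (2 * k + 1) * D - r * k * E : ℝ) = p) (hp1 : r * (r - 1) ≤ p)
    (h : (((1 + r * (r - 1) / p) ^ r - 1 - r * (r * (r - 1) / p)) / (r * (r - 1) / p) ^ 2) ^ k -
      r.choose 2 ^ k - k * (r.choose 3 * (r * (r - 1) / p) * r.choose 2 ^ (k - 1)) <
        r * (r - 1) / 2)
    (hℓ : r < r * k) : ¬ (tightCycle r (r * k) hℓ.le).IsSidorenko := by
  have hr' : (1 : ℝ) < r := by exact_mod_cast hr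
  have hrr : (0 : ℝ) < r * (r - 1) := mul_pos (by linarith) (by linarith)
  have hodd := oddBound_le (r := r) (k := k) (by omega) (by omega)
  rw [oddBound, hD, hE, hp] at hodd
  exact not_isSidorenko_of_even_lt hr hk hp1 hodd
    ((sum_even_le_blocks (by omega) (by omega) (div_pos hrr (by linarith)) _).trans_lt h) hℓ

theorem not_isSidorenko_five_three (hℓ : 5 < 5 * 3) :
    ¬ (tightCycle 5 (5 * 3) hℓ.le).IsSidorenko :=
  not_isSidorenko_of_blocks 462 35 465 (by norm_num) (by norm_num) (by decide +kernel)
    (by decide +kernel) (by norm_num) (by norm_num) (by norm_num [Nat.choose]) hℓ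

theorem not_isSidorenko_seven_three (hℓ : 7 < 7 * 3) :
    ¬ (tightCycle 7 (7 * 3) hℓ.le).IsSidorenko :=
  not_isSidorenko_of_blocks 1716 84 3384 (by norm_num) (by norm_num) (by decide +kernel)
    (by decide +kernel) (by norm_num) (by norm_num) (by norm_num [Nat.choose]) hℓ

theorem not_isSidorenko_nine_three (hℓ : 9 < 9 * 3) :
    ¬ (tightCycle 9 (9 * 3) hℓ.le).IsSidorenko :=
  not_isSidorenko_of_blocks 5005 165 14850 (by norm_num) (by norm_num) (by decide +kernel)
    (by decide +kernel) (by norm_num) (by norm_num) (by norm_num [Nat.choose]) hℓ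

end BlockCases

/-! ### Small exceptional cases -/

section Exceptional

/-- A criterion for a single pair `(r, k)`: the number of covers with `2k + 2` edges is at most
`N₁`, and those with more edges are bounded by the general estimates. -/
theorem not_isSidorenko_of_numbers {r k : ℕ} (A D E C C' : ℕ) (N₁ p : ℝ) (hr : 5 ≤ r) (hk : 4 ≤ k)
    (hA : (k + r).choose r = A) (hD : (2 * k + r).choose r = D)
    (hE : (k + r - 1).choose (r - 1) = E) (hC : (k + 1 + 2 * r).choose (2 * r) = C)
    (hC' : (k + 2 + 3 * r).choose (3 * r) = C')
    (hp : (r * k / (2 * k + 1) * D - r * k * E : ℝ) = p) (hp1 : r * (r - 1) ≤ p)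
    (hN₁ : (doubleCovers r (r * k) (2 * (k + 1))).card ≤ N₁)
    (hσ : r * (r - 1) / p * A < 2)
    (h : N₁ * (r * (r - 1) / p) ^ 2 + (r * (r - 1) / 2) *
      ((k / (k + 2)) * (C * (r * (r - 1) / p) ^ 2) ^ 2 + (k / (k + 3)) *
        (C' * (r * (r - 1) / p) ^ 3) ^ 2 / (1 - (r * (r - 1) / p * A) ^ 2 / 4)) < r * (r - 1) / 2)
    (hℓ : r < r * k) : ¬ (tightCycle r (r * k) hℓ.le).IsSidorenko := by
  have hr' : (5 : ℝ) ≤ r := by exact_mod_cast hr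
  have hrr : (0 : ℝ) < r * (r - 1) := mul_pos (by linarith) (by linarith)
  have hodd := oddBound_le (r := r) (k := k) (by omega) (by omega)
  rw [oddBound, hD, hE, hp] at hodd
  refine not_isSidorenko_of_even_lt (by omega) (by omega) hp1 hodd ?_ hℓ
  have hc : 0 < r * (r - 1) / p := div_pos hrr (by linarith)
  have e1 : evenChoose r k 1 = A := by
    rw [evenChoose, mul_one, show k + 1 + r - 1 = k + r by omega, hA]
  have e2 : evenChoose r k 2 = C := by
    rw [evenChoose, mul_comm r 2, show k + 2 + 2 * r - 1 = k + 1 + 2 * r by omega, hC]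
  have e3 : evenChoose r k 3 = C' := by
    rw [evenChoose, mul_comm r 3, show k + 3 + 3 * r - 1 = k + 2 + 3 * r by omega, hC']
  have htail := sum_even_le (r := r) (k := k) (by omega) (by omega) (Or.inl ⟨hk, hr⟩) hc.le
    le_rfl (by rw [e1]; exact hσ) (a := 3) (by norm_num) (r * k)
  have h2 := card_doubleCovers_even_le (r := r) (k := k) (by omega) (by omega) 2
  rw [e1, e3] at htail
  rw [e2] at h2
  have hrk : 5 * 4 ≤ r * k := Nat.mul_le_mul hr hk
  rw [← Finset.add_sum_Ioc_eq_sum_Icc (show 1 ≤ r * k by omega)]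
  change _ + ∑ t ∈ Finset.Icc 2 (r * k), _ < _
  rw [← Finset.add_sum_Ioc_eq_sum_Icc (show 2 ≤ r * k by omega)]
  refine lt_of_le_of_lt (add_le_add (mul_le_mul_of_nonneg_right hN₁ (by positivity))
    (add_le_add (mul_le_mul_of_nonneg_right h2 (by positivity)) htail)) (lt_of_eq_of_lt ?_ h)
  push_cast
  ring

/-- The general estimate for the number of double covers with `2k + 2` edges. -/
theorem card_doubleCovers_add_two_le {r k : ℕ} (A : ℕ) (hr : 0 < r) (hk : 0 < k)
    (hA : (k + r).choose r = A) : ((doubleCovers r (r * k) (2 * (k + 1))).card : ℝ) ≤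
      (r * (r - 1) / 2) * ((k / (k + 1)) * (A : ℝ) ^ 2) := by
  have h := card_doubleCovers_even_le hr hk 1
  rwa [evenChoose, mul_one, show k + 1 + r - 1 = k + r by omega, hA, Nat.cast_one] at h

theorem not_isSidorenko_five_seven (hℓ : 5 < 5 * 7) :
    ¬ (tightCycle 5 (5 * 7) hℓ.le).IsSidorenko :=
  not_isSidorenko_of_numbers 792 11628 330 43758 1307504 _ 15582 (by norm_num) (by norm_num)
    (by decide +kernel) (by decide +kernel) (by decide +kernel) (by decide +kernel)
    (by decide +kernel) (by norm_num) (by norm_num)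
    (card_doubleCovers_add_two_le 792 (by norm_num) (by norm_num) (by decide +kernel))
    (by norm_num) (by norm_num) hℓ

theorem not_isSidorenko_five_eight (hℓ : 5 < 5 * 8) :
    ¬ (tightCycle 5 (5 * 8) hℓ.le).IsSidorenko :=
  not_isSidorenko_of_numbers 1287 20349 495 92378 3268760 _ 28080 (by norm_num) (by norm_num)
    (by decide +kernel) (by decide +kernel) (by decide +kernel) (by decide +kernel)
    (by decide +kernel) (by norm_num) (by norm_num)
    (card_doubleCovers_add_two_le 1287 (by norm_num) (by norm_num) (by decide +kernel))
    (by norm_num) (by norm_num) hℓ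

theorem not_isSidorenko_seven_four (hℓ : 7 < 7 * 4) :
    ¬ (tightCycle 7 (7 * 4) hℓ.le).IsSidorenko :=
  not_isSidorenko_of_numbers 330 6435 210 11628 296010 _ 14140 (by norm_num) (by norm_num)
    (by decide +kernel) (by decide +kernel) (by decide +kernel) (by decide +kernel)
    (by decide +kernel) (by norm_num) (by norm_num)
    (card_doubleCovers_add_two_le 330 (by norm_num) (by norm_num) (by decide +kernel))
    (by norm_num) (by norm_num) hℓ

end Exceptional

section GapPolynomials

open Polynomial in
/-- The generating polynomial, by total sum, of the words of `n` positive integers that can be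
inserted between `p` and `q` such that any two neighbours sum to at most `r`. -/
noncomputable def gapPoly (r q : ℕ) : ℕ → ℕ → ℕ[X]
  | 0, p => if p + q ≤ r then 1 else 0
  | n + 1, p => ∑ g ∈ Finset.Icc 1 (r - p), X ^ g * gapPoly r q n g

theorem card_le_coeff_gapPoly {r q : ℕ} (n : ℕ) : ∀ (p s : ℕ) (G : Finset (ℕ → ℕ)),
    (∀ g ∈ G, g 0 = p ∧ g (n + 1) = q ∧ (∀ i, n + 1 < i → g i = 0) ∧
      (∀ i < n, 1 ≤ g (i + 1)) ∧ (∀ i ≤ n, g i + g (i + 1) ≤ r) ∧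
      ∑ i ∈ Finset.range n, g (i + 1) = s) → G.card ≤ (gapPoly r q n p).coeff s := by
  classical
  induction n with
  | zero =>
    intro p s G hG
    have hcard : G.card ≤ 1 := by
      rw [Finset.card_le_one]
      intro g hg h hh
      obtain ⟨h1, h2, h3, -⟩ := hG g hg
      obtain ⟨h1', h2', h3', -⟩ := hG h hh
      funext i
      rcases i with _ | _ | i
      · rw [h1, h1']
      · exact h2.trans h2'.symm
      · rw [h3 _ (by omega), h3' _ (by omega)]
    rcases G.eq_empty_or_nonempty with rfl | ⟨g, hg⟩
    · simp
    obtain ⟨h1, h2, -, -, h5, h6⟩ := hG g hg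
    have h7 := h5 0 le_rfl
    rw [h1, h2] at h7
    simp only [Finset.range_zero, Finset.sum_empty] at h6
    rw [gapPoly, if_pos h7, ← h6]
    simpa using hcard
  | succ n ih =>
    intro p s G hG
    have hmaps : ∀ g ∈ G, g 1 ∈ Finset.Icc 1 (r - p) := by
      intro g hg
      obtain ⟨h1, -, -, h4, h5, -⟩ := hG g hg
      have h6 := h5 0 (by omega)
      have h7 := h4 0 (by omega)
      rw [zero_add] at h6 h7
      exact Finset.mem_Icc.2 ⟨h7, by omega⟩
    rw [gapPoly, Polynomial.finsetSum_coeff, Finset.card_eq_sum_card_fiberwise hmaps]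
    refine Finset.sum_le_sum fun v hv => ?_
    rw [Polynomial.coeff_X_pow_mul']
    rcases (G.filter fun g => g 1 = v).eq_empty_or_nonempty with he | ⟨g₀, hg₀⟩
    · rw [he]
      simp
    have hsum : ∀ g ∈ G.filter fun g => g 1 = v,
        ∑ i ∈ Finset.range n, g (i + 1 + 1) + v = s := by
      intro g hg
      obtain ⟨hgG, hgv⟩ := Finset.mem_filter.1 hg
      obtain ⟨-, -, -, -, -, h6⟩ := hG g hgG
      rw [Finset.sum_range_succ', zero_add, hgv] at h6
      exact h6
    have h0 := hsum g₀ hg₀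
    rw [if_pos (by omega)]
    rw [← Finset.card_image_of_injOn (f := fun (g : ℕ → ℕ) i => g (i + 1))]
    · refine ih v (s - v) _ fun g' hg' => ?_
      obtain ⟨g, hg, rfl⟩ := Finset.mem_image.1 hg'
      obtain ⟨hgG, hgv⟩ := Finset.mem_filter.1 hg
      obtain ⟨h1, h2, h3, h4, h5, -⟩ := hG g hgG
      refine ⟨hgv, h2, fun i hi => h3 _ (by omega), fun i hi => h4 _ (by omega),
        fun i hi => h5 _ (by omega), ?_⟩
      have := hsum g hg
      simp only
      omega
    · intro g hg h hh hgh
      have h1 := (hG g (Finset.mem_filter.1 hg).1).1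
      have h1' := (hG h (Finset.mem_filter.1 hh).1).1
      funext i
      rcases i with _ | i
      · rw [h1, h1']
      · exact congrFun hgh i

theorem coeff_gapPoly_le (r q n : ℕ) : ∀ p s, (gapPoly r q n p).coeff s ≤ r ^ n := by
  induction n with
  | zero =>
    intro p s
    rw [gapPoly]
    split_ifs
    · rw [Polynomial.coeff_one]
      split_ifs <;> simp
    · simp
  | succ n ih =>
    intro p s
    rw [gapPoly, Polynomial.finsetSum_coeff]
    calc _ ≤ ∑ g ∈ Finset.Icc 1 (r - p), r ^ n := by
          refine Finset.sum_le_sum fun g _ => ?_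
          rw [Polynomial.coeff_X_pow_mul']
          split_ifs
          · exact ih _ _
          · exact Nat.zero_le _
      _ ≤ r ^ (n + 1) := by
          rw [Finset.sum_const, Nat.card_Icc, smul_eq_mul, pow_succ, mul_comm]
          exact Nat.mul_le_mul_left _ (by omega)

/-- A coefficient of a polynomial with small coefficients can be read off from the digits of the
value at a large number. -/
theorem coeff_mul_pow_le_eval_mod {B : ℕ} {P : Polynomial ℕ} (hP : ∀ s, P.coeff s < B) (s : ℕ) :
    P.coeff s * B ^ s ≤ P.eval B % B ^ (s + 1) := by
  have hlow : ∀ t, ∑ i ∈ Finset.range t, P.coeff i * B ^ i < B ^ t := by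
    intro t
    induction t with
    | zero => simp
    | succ t ih =>
      rw [Finset.sum_range_succ, pow_succ]
      have h1 : (P.coeff t + 1) * B ^ t ≤ B * B ^ t := Nat.mul_le_mul_right _ (hP t)
      rw [Nat.add_mul, one_mul] at h1
      rw [mul_comm (B ^ t) B]
      omega
  have hN : P.natDegree + 1 ≤ (s + 1) + (P.natDegree + 1) := by omega
  rw [Polynomial.eval_eq_sum_range' (Nat.lt_of_succ_le hN), Finset.sum_range_add]
  have hdvd : B ^ (s + 1) ∣ ∑ i ∈ Finset.range (P.natDegree + 1),
      P.coeff (s + 1 + i) * B ^ (s + 1 + i) :=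
    Finset.dvd_sum fun i _ => Dvd.dvd.mul_left (pow_dvd_pow B (by omega)) _
  obtain ⟨c, hc⟩ := hdvd
  rw [hc, Nat.add_mul_mod_self_left, Nat.mod_eq_of_lt (hlow (s + 1)), Finset.sum_range_succ]
  exact Nat.le_add_left _ _

/-- The gaps between consecutive members of a based double cover form a cyclic word in which
neighbours sum to at most `r`. -/
theorem card_basedDoubleCovers_le_coeff {r ℓ m : ℕ} [NeZero ℓ] (hr : r ≤ ℓ) (hm : 0 < m) :
    (basedDoubleCovers r ℓ m).card ≤
      (∑ v ∈ Finset.Icc 1 (r - 1), Polynomial.X ^ v * gapPoly r v (m - 1) v).coeff ℓ := by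
  classical
  have hmaps : ∀ F ∈ basedDoubleCovers r ℓ m, cyclicEnum F 1 ∈ Finset.Icc 1 (r - 1) := by
    intro F hF
    obtain ⟨hmono, h0, -, h2⟩ := cyclicEnum_spec hr hF
    have h3 := hmono (show 0 < 1 by norm_num)
    have h4 := hmono (show 1 < 2 by norm_num)
    have h5 : cyclicEnum F 2 ≤ cyclicEnum F 0 + r := h2 0
    exact Finset.mem_Icc.2 ⟨by omega, by omega⟩
  rw [Polynomial.finsetSum_coeff, Finset.card_eq_sum_card_fiberwise hmaps]
  refine Finset.sum_le_sum fun v hv => ?_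
  rw [Polynomial.coeff_X_pow_mul']
  have hv' := Finset.mem_Icc.1 hv
  rw [if_pos (by omega)]
  set word : Finset (Fin ℓ) → ℕ → ℕ := fun F i =>
    if i ≤ m then cyclicEnum F (i + 1) - cyclicEnum F i else 0 with hword
  have hsum : ∀ F ∈ basedDoubleCovers r ℓ m, ∀ n ≤ m,
      ∑ i ∈ Finset.range n, word F i = cyclicEnum F n := by
    intro F hF n hn
    obtain ⟨hmono, h0, -, -⟩ := cyclicEnum_spec hr hF
    induction n with
    | zero => simp [h0]
    | succ n ih =>
      have h3 := hmono (Nat.lt_add_one n)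
      rw [Finset.sum_range_succ, ih (by omega), hword]
      simp only
      rw [if_pos (by omega)]
      omega
  rw [← Finset.card_image_of_injOn (f := word)]
  · refine card_le_coeff_gapPoly (m - 1) v (ℓ - v) _ fun g hg => ?_
    obtain ⟨F, hF, rfl⟩ := Finset.mem_image.1 hg
    obtain ⟨hF, hFv⟩ := Finset.mem_filter.1 hF
    obtain ⟨hmono, h0, hper, h2⟩ := cyclicEnum_spec hr hF
    have hm1 : m - 1 + 1 = m := by omega
    have hw0 : word F 0 = v := by simp [hword, h0, hFv]
    refine ⟨hw0, ?_, ?_, ?_, ?_, ?_⟩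
    · have h3 := hper 0
      have h4 := hper 1
      rw [zero_add] at h3
      rw [hm1, hword]
      simp only [le_refl, if_true]
      rw [add_comm m 1]
      omega
    · intro i hi
      rw [hword]
      simp only
      rw [if_neg (by omega)]
    · intro i hi
      have h3 := hmono (Nat.lt_add_one (i + 1))
      rw [hword]
      simp only
      rw [if_pos (by omega)]
      omega
    · intro i hi
      have h3 := hmono (Nat.lt_add_one i)
      have h4 := hmono (Nat.lt_add_one (i + 1))
      have h5 := h2 i
      rw [hword]
      simp only
      rw [if_pos (by omega), if_pos (by omega)]
      have h6 : cyclicEnum F (i + 2) = cyclicEnum F (i + 1 + 1) := rfl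
      omega
    · have h3 := hsum F hF m le_rfl
      have h4 := hper 0
      rw [zero_add, h0] at h4
      rw [← hm1, Finset.sum_range_succ', hm1, hw0] at h3
      omega
  · intro F hF G hG hFG
    have hF' := (Finset.mem_filter.1 hF).1
    have hG' := (Finset.mem_filter.1 hG).1
    obtain ⟨-, -, hper, -⟩ := cyclicEnum_spec hr hF'
    obtain ⟨-, -, hper', -⟩ := cyclicEnum_spec hr hG'
    refine cyclicEnum_injOn ⟨0, (Finset.mem_filter.1 hF').2⟩ ⟨0, (Finset.mem_filter.1 hG').2⟩
      (cyclic_seq_ext hm hper hper' fun n hn => ?_)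
    rw [← hsum F hF' n hn.le, ← hsum G hG' n hn.le, hFG]

/-- The values at `B` of the generating polynomials for `r = 5` of the words that follow the letters
`1`, `2`, `3` and `4`. -/
def gapEval (B q : ℕ) : ℕ → ℕ × ℕ × ℕ × ℕ
  | 0 => (if 1 + q ≤ 5 then 1 else 0, if 2 + q ≤ 5 then 1 else 0, if 3 + q ≤ 5 then 1 else 0,
      if 4 + q ≤ 5 then 1 else 0)
  | n + 1 =>
    let v := gapEval B q n
    (B * v.1 + B ^ 2 * v.2.1 + B ^ 3 * v.2.2.1 + B ^ 4 * v.2.2.2,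
      B * v.1 + B ^ 2 * v.2.1 + B ^ 3 * v.2.2.1, B * v.1 + B ^ 2 * v.2.1, B * v.1)

theorem eval_gapPoly (B q n : ℕ) : (gapPoly 5 q n 1).eval B = (gapEval B q n).1 ∧
    (gapPoly 5 q n 2).eval B = (gapEval B q n).2.1 ∧
    (gapPoly 5 q n 3).eval B = (gapEval B q n).2.2.1 ∧
    (gapPoly 5 q n 4).eval B = (gapEval B q n).2.2.2 := by
  induction n with
  | zero =>
    simp only [gapPoly, gapEval]
    refine ⟨?_, ?_, ?_, ?_⟩ <;> split_ifs <;> simp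
  | succ n ih =>
    obtain ⟨h1, h2, h3, h4⟩ := ih
    simp only [gapPoly, gapEval, ← h1, ← h2, ← h3, ← h4]
    refine ⟨?_, ?_, ?_, ?_⟩ <;>
      simp [Finset.sum_Icc_succ_top, Polynomial.eval_add]

theorem card_basedDoubleCovers_five_le {k m N : ℕ} (hk : 0 < k) (hm : 0 < m) (hm2 : m ≤ 14)
    (hN : ((10 ^ 10) * (gapEval (10 ^ 10) 1 (m - 1)).1 +
      (10 ^ 10) ^ 2 * (gapEval (10 ^ 10) 2 (m - 1)).2.1 +
      (10 ^ 10) ^ 3 * (gapEval (10 ^ 10) 3 (m - 1)).2.2.1 +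
      (10 ^ 10) ^ 4 * (gapEval (10 ^ 10) 4 (m - 1)).2.2.2) % (10 ^ 10) ^ (5 * k + 1) <
        (N + 1) * (10 ^ 10) ^ (5 * k)) :
    have : NeZero (5 * k) := ⟨by omega⟩
    (basedDoubleCovers 5 (5 * k) m).card ≤ N := by
  intro
  refine (card_basedDoubleCovers_le_coeff (by omega) hm).trans ?_
  have h1 := coeff_mul_pow_le_eval_mod (B := 10 ^ 10)
    (P := ∑ v ∈ Finset.Icc 1 (5 - 1), Polynomial.X ^ v * gapPoly 5 v (m - 1) v) ?_ (5 * k)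
  · have h2 : (∑ v ∈ Finset.Icc 1 (5 - 1), Polynomial.X ^ v * gapPoly 5 v (m - 1) v).eval
        (10 ^ 10) = (10 ^ 10) * (gapEval (10 ^ 10) 1 (m - 1)).1 +
        (10 ^ 10) ^ 2 * (gapEval (10 ^ 10) 2 (m - 1)).2.1 +
        (10 ^ 10) ^ 3 * (gapEval (10 ^ 10) 3 (m - 1)).2.2.1 +
        (10 ^ 10) ^ 4 * (gapEval (10 ^ 10) 4 (m - 1)).2.2.2 := by
      rw [← (eval_gapPoly (10 ^ 10) 1 (m - 1)).1, ← (eval_gapPoly (10 ^ 10) 2 (m - 1)).2.1,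
        ← (eval_gapPoly (10 ^ 10) 3 (m - 1)).2.2.1, ← (eval_gapPoly (10 ^ 10) 4 (m - 1)).2.2.2]
      simp [Finset.sum_Icc_succ_top, Polynomial.eval_add]
    rw [h2] at h1
    exact Nat.lt_succ_iff.1 (Nat.lt_of_mul_lt_mul_right (h1.trans_lt hN))
  · intro s
    rw [Polynomial.finsetSum_coeff]
    calc _ ≤ ∑ v ∈ Finset.Icc 1 (5 - 1), 5 ^ (m - 1) := by
          refine Finset.sum_le_sum fun v _ => ?_
          rw [Polynomial.coeff_X_pow_mul']
          split_ifs
          · exact coeff_gapPoly_le _ _ _ _ _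
          · exact Nat.zero_le _
      _ ≤ ∑ v ∈ Finset.Icc 1 (5 - 1), 5 ^ 13 := by
          gcongr
          · norm_num
          · omega
      _ < 10 ^ 10 := by norm_num

/-- A bound for the number of double covers with `2k + 2` edges for `r = 5`, through the values of
the generating polynomials at `10 ^ 10`, a number larger than all their coefficients. -/
theorem card_doubleCovers_five_le {k N : ℕ} (hk : 0 < k) (hk2 : k ≤ 6)
    (hN : ((10 ^ 10) * (gapEval (10 ^ 10) 1 (2 * k + 1)).1 +
      (10 ^ 10) ^ 2 * (gapEval (10 ^ 10) 2 (2 * k + 1)).2.1 +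
      (10 ^ 10) ^ 3 * (gapEval (10 ^ 10) 3 (2 * k + 1)).2.2.1 +
      (10 ^ 10) ^ 4 * (gapEval (10 ^ 10) 4 (2 * k + 1)).2.2.2) % (10 ^ 10) ^ (5 * k + 1) <
        (N + 1) * (10 ^ 10) ^ (5 * k)) :
    ((doubleCovers 5 (5 * k) (2 * (k + 1))).card : ℝ) ≤ 5 * k * N / (2 * (k + 1)) := by
  have : NeZero (5 * k) := ⟨by omega⟩
  have h1 := mul_card_doubleCovers (r := 5) (ℓ := 5 * k) (by omega) (2 * (k + 1))
  have h2 := card_basedDoubleCovers_five_le (m := 2 * (k + 1)) hk (by omega) (by omega) hN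
  rw [le_div_iff₀ (by positivity)]
  have h3 : 2 * (k + 1) * (doubleCovers 5 (5 * k) (2 * (k + 1))).card ≤ 5 * k * N := by
    rw [h1]
    exact Nat.mul_le_mul_left _ h2
  have h4 : (2 * (k + 1) * (doubleCovers 5 (5 * k) (2 * (k + 1))).card : ℝ) ≤ 5 * k * N := by
    exact_mod_cast h3
  linarith

theorem not_isSidorenko_five_four (hℓ : 5 < 5 * 4) :
    ¬ (tightCycle 5 (5 * 4) hℓ.le).IsSidorenko :=
  not_isSidorenko_of_numbers 126 1287 70 3003 54264 _ 1460 (by norm_num) (by norm_num)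
    (by decide +kernel) (by decide +kernel) (by decide +kernel) (by decide +kernel)
    (by decide +kernel) (by norm_num) (by norm_num)
    (card_doubleCovers_five_le (N := 6453) (by norm_num) (by norm_num) (by decide +kernel))
    (by norm_num) (by norm_num) hℓ

theorem not_isSidorenko_five_five (hℓ : 5 < 5 * 5) :
    ¬ (tightCycle 5 (5 * 5) hℓ.le).IsSidorenko :=
  not_isSidorenko_of_numbers 252 3003 126 8008 170544 _ 3675 (by norm_num) (by norm_num)
    (by decide +kernel) (by decide +kernel) (by decide +kernel) (by decide +kernel)
    (by decide +kernel) (by norm_num) (by norm_num)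
    (card_doubleCovers_five_le (N := 29736) (by norm_num) (by norm_num) (by decide +kernel))
    (by norm_num) (by norm_num) hℓ

theorem not_isSidorenko_five_six (hℓ : 5 < 5 * 6) :
    ¬ (tightCycle 5 (5 * 6) hℓ.le).IsSidorenko :=
  not_isSidorenko_of_numbers 462 6188 210 19448 490314 _ 7980 (by norm_num) (by norm_num)
    (by decide +kernel) (by decide +kernel) (by decide +kernel) (by decide +kernel)
    (by decide +kernel) (by norm_num) (by norm_num)
    (card_doubleCovers_five_le (N := 110649) (by norm_num) (by norm_num) (by decide +kernel))
    (by norm_num) (by norm_num) hℓ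

end GapPolynomials

/-! ### All tight cycles -/

theorem not_isSidorenko_of_dvd {r k : ℕ} (hr : 3 ≤ r) (hodd : Odd r) (hk : 2 ≤ k)
    (hℓ : r < r * k) : ¬ (tightCycle r (r * k) hℓ.le).IsSidorenko := by
  obtain ⟨s, rfl⟩ := hodd
  rcases Nat.lt_or_ge s 2 with hs | hs
  · obtain rfl : s = 1 := by omega
    exact not_isSidorenko_three hk hℓ
  rcases Nat.lt_or_ge k 3 with hk3 | hk3
  · obtain rfl : k = 2 := by omega
    exact not_isSidorenko_two (by omega) hℓ
  by_cases hlarge : 9 ≤ k ∧ 5 ≤ 2 * s + 1 ∨ 5 ≤ k ∧ 7 ≤ 2 * s + 1 ∨ k = 4 ∧ 9 ≤ 2 * s + 1 ∨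
      k = 3 ∧ 11 ≤ 2 * s + 1
  · exact not_isSidorenko_of_oddBoundLarge (by omega) (oddBoundLarge_of_lt hlarge) hℓ
  have hs5 : s < 5 := by omega
  have hk9 : k < 9 := by omega
  interval_cases s
  · interval_cases k
    · exact not_isSidorenko_five_three hℓ
    · exact not_isSidorenko_five_four hℓ
    · exact not_isSidorenko_five_five hℓ
    · exact not_isSidorenko_five_six hℓ
    · exact not_isSidorenko_five_seven hℓ
    · exact not_isSidorenko_five_eight hℓ
  · obtain rfl | rfl : k = 3 ∨ k = 4 := by omega
    · exact not_isSidorenko_seven_three hℓ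
    · exact not_isSidorenko_seven_four hℓ
  · obtain rfl : k = 3 := by omega
    exact not_isSidorenko_nine_three hℓ

theorem mainTheorem3 (r ℓ : ℕ) (hr : 3 ≤ r) (hodd : Odd r) (hℓ : r < ℓ) :
    ¬ (tightCycle r ℓ hℓ.le).IsSidorenko := by
  by_cases hdvd : r ∣ ℓ
  · obtain ⟨k, rfl⟩ := hdvd
    have hk : 2 ≤ k := by
      by_contra h
      have : r * k ≤ r * 1 := Nat.mul_le_mul_left r (by omega)
      omega
    exact not_isSidorenko_of_dvd hr hodd hk hℓ
  · exact not_isSidorenko_of_not_dvd (by omega) hℓ hdvd
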